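/- Let $\Bbbk$ be a field and $d\ge 1$ an integer. For a quiver $Q$ with finitely many vertices, let $\Bbbk Q$ be its path algebra, with paths composed like functions ($qp$ is "first $p$, then $q$") and $e_i$ the trivial path at the vertex $i$. Let $A=\Bbbk Q_A/\mathcal R_A$ and $B=\Bbbk Q_B/\mathcal R_B$ be finite dimensional algebras, where $\mathcal R_A,\mathcal R_B$ are two-sided ideals; let $a$ be a sink of $Q_A$ (no arrow starts at $a$) with $e_a\notin\mathcal R_A$, and $b$ a source of $Q_B$ (no arrow ends at $b$) with $e_b\notin\mathcal R_B$. Let $Q_\Lambda$ be the quiver obtained from the disjoint union of $Q_A$ and $Q_B$ by identifying $a$ with $b$, put $e_A=\sum_{i\in (Q_A)_0}e_i$ and $e_B=\sum_{i\in (Q_B)_0}e_i$ in $\Bbbk Q_\Lambda$, and let $$\Lambda=A\Delta_S B=\Bbbk Q_\Lambda/\mathcal R_\Lambda,\qquad \mathcal R_\Lambda=\langle \mathcal R_A+\mathcal R_B+(1-e_A)\Bbbk Q_\Lambda(1-e_B)\rangle$$ be the sink-source gluing of $A$ and $B$, where $S$ denotes the simple $\Lambda$-module at the vertex $a=b$.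 The surjections $\Bbbk Q_\Lambda\to\Bbbk Q_A$ and $\Bbbk Q_\Lambda\to\Bbbk Q_B$ that fix the paths of $Q_A$, respectively $Q_B$, and send all other paths to zero induce algebra maps $\Lambda\to A$ and $\Lambda\to B$; restricting scalars along these, we regard $\mathrm{mod}\,A$ and $\mathrm{mod}\,B$ (finitely generated right modules) as full subcategories of $\mathrm{mod}\,\Lambda$. For a finite dimensional algebra $C$, a full subcategory $\mathcal M\subseteq\mathrm{mod}\,C$ is called $d$-cluster tilting if it is functorially finite in $\mathrm{mod}\,C$ (every module has a left and a right $\mathcal M$-approximation), generating and cogenerating, and $$\mathcal M=\{X\in\mathrm{mod}\,C\mid \mathrm{Ext}^i_C(X,\mathcal M)=0,\ 1\le i\le d-1\}=\{X\in\mathrm{mod}\,C\mid \mathrm{Ext}^i_C(\mathcal M,X)=0,\ 1\le i\le d-1\}.$$ It is called $d\mathbb Z$-cluster tilting if moreover $\mathrm{Ext}^i_C(\mathcal M,\mathcal M)\ne 0$ implies $i\in d\mathbb Z$. Let $\mathcal M_A\subseteq\mathrm{mod}\,A$ and $\mathcal M_B\subseteq\mathrm{mod}\,B$ be $d$-cluster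 tilting subcategories. Then $\mathcal M_A\Delta_S\mathcal M_B=\mathrm{add}\{\mathcal M_A,\mathcal M_B\}$, the full subcategory of $\mathrm{mod}\,\Lambda$ consisting of the direct summands of finite direct sums of modules from $\mathcal M_A$ and $\mathcal M_B$, is a $d$-cluster tilting subcategory of $\mathrm{mod}\,\Lambda$. If moreover $\mathcal M_A$ and $\mathcal M_B$ are $d\mathbb Z$-cluster tilting, then $\mathcal M_A\Delta_S\mathcal M_B$ is $d\mathbb Z$-cluster tilting. -/

import Mathlib

open CategoryTheory CategoryTheory.Limits

universe u

set_option linter.unusedSectionVars false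

/-! ### Path algebras

Paths are composed like functions: if `p` is a path from `i` to `j` and `q` is a path from `j` to
`l`, then `q * p` is the path "first `p`, then `q`" in the path algebra.  In particular
`e_j * p * e_i = p` for a path `p` from `i` to `j`. -/

/-- The set of all paths (of any length, including the trivial ones) of a quiver. -/
abbrev TotalPath (V : Type u) [Quiver.{u} V] : Type u := Σ i j : V, Quiver.Path i j

/-- The path algebra `k Q`: the `k`-vector space with basis the paths of the quiver. -/
def PathAlgebra (k : Type u) [Field k] (V : Type u) [Quiver.{u} V] : Type u := TotalPath V →₀ k

namespace PathAlgebra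

section Basic

variable (k : Type u) [Field k] {V : Type u} [Quiver.{u} V]

noncomputable instance : AddCommGroup (PathAlgebra k V) :=
  inferInstanceAs (AddCommGroup (TotalPath V →₀ k))

noncomputable instance : Module k (PathAlgebra k V) :=
  inferInstanceAs (Module k (TotalPath V →₀ k))

/-- A path, as a basis element of the path algebra. -/
noncomputable def ofPath {i j : V} (p : Quiver.Path i j) : PathAlgebra k V :=
  Finsupp.single (⟨i, j, p⟩ : TotalPath V) (1 : k)

/-- The idempotent of a vertex, i.e. the trivial path `e_i`. -/
noncomputable def vertex (i : V) : PathAlgebra k V := ofPath k (Quiver.Path.nil : Quiver.Path i i)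

/-- An arrow, as an element of the path algebra. -/
noncomputable def arrow {i j : V} (α : i ⟶ j) : PathAlgebra k V := ofPath k α.toPath

/-- The linear map out of the path algebra with prescribed values on paths. -/
noncomputable def linearLift {M : Type u} [AddCommGroup M] [Module k M] (φ : TotalPath V → M) :
    PathAlgebra k V →ₗ[k] M :=
  Finsupp.linearCombination k φ

variable {k} in
lemma linearLift_ofPath {M : Type u} [AddCommGroup M] [Module k M] (φ : TotalPath V → M)
    {i j : V} (p : Quiver.Path i j) : linearLift k φ (ofPath k p) = φ ⟨i, j, p⟩ := by
  unfold linearLift ofPath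
  exact (Finsupp.linearCombination_single k (1 : k) _).trans (one_smul k _)

variable {k} in
lemma induction_path {P : PathAlgebra k V → Prop} (x : PathAlgebra k V) (zero : P 0)
    (add : ∀ x y, P x → P y → P (x + y)) (smul : ∀ (c : k) x, P x → P (c • x))
    (path : ∀ (i j : V) (p : Quiver.Path i j), P (ofPath k p)) : P x := by
  refine Finsupp.induction_linear (motive := P) x zero add ?_
  rintro ⟨i, j, p⟩ c
  have h := smul c _ (path i j p)
  have e : c • ofPath k p = (Finsupp.single (⟨i, j, p⟩ : TotalPath V) c : TotalPath V →₀ k) := by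
    unfold ofPath
    exact (Finsupp.smul_single_one _ _)
  rw [e] at h
  exact h

open Classical in
/-- The product `x * y` of two paths: "first `y`, then `x`" if `y` ends where `x` starts, and zero
otherwise. -/
noncomputable def pathMul (x y : TotalPath V) : PathAlgebra k V :=
  if h : y.2.1 = x.1 then ofPath k ((y.2.2.cast rfl h).comp x.2.2) else 0

noncomputable def mulLin : PathAlgebra k V →ₗ[k] PathAlgebra k V →ₗ[k] PathAlgebra k V :=
  linearLift k fun x => linearLift k fun y => pathMul k x y

noncomputable instance : Mul (PathAlgebra k V) := ⟨fun x y => mulLin k x y⟩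

variable {k}

lemma mul_def (x y : PathAlgebra k V) : x * y = mulLin k x y := rfl

lemma ofPath_mul_ofPath {i j l : V} (q : Quiver.Path j l) (p : Quiver.Path i j) :
    ofPath k q * ofPath k p = ofPath k (p.comp q) := by
  simp [mul_def, mulLin, linearLift_ofPath, pathMul]

lemma ofPath_mul_ofPath_of_ne {i j j' l : V} (q : Quiver.Path j' l) (p : Quiver.Path i j)
    (h : j ≠ j') : ofPath k q * ofPath k p = 0 := by
  simp [mul_def, mulLin, linearLift_ofPath, pathMul, h]

/-- The unit `∑ e_i` of the path algebra of a quiver with finitely many vertices. -/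
noncomputable instance [Finite V] : One (PathAlgebra k V) :=
  ⟨letI := Fintype.ofFinite V; ∑ i : V, vertex k i⟩

lemma one_def [Fintype V] : (1 : PathAlgebra k V) = ∑ i : V, vertex k i := by
  change (letI := Fintype.ofFinite V; ∑ i : V, vertex k i) = _
  congr!

protected lemma mul_add' (x y z : PathAlgebra k V) : x * (y + z) = x * y + x * z := by
  simp [mul_def]

protected lemma add_mul' (x y z : PathAlgebra k V) : (x + y) * z = x * z + y * z := by
  simp [mul_def]

protected lemma zero_mul' (x : PathAlgebra k V) : 0 * x = 0 := by simp [mul_def]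

protected lemma mul_zero' (x : PathAlgebra k V) : x * 0 = 0 := by simp [mul_def]

protected lemma smul_mul' (c : k) (x y : PathAlgebra k V) : (c • x) * y = c • (x * y) := by
  simp [mul_def]

protected lemma mul_smul' (c : k) (x y : PathAlgebra k V) : x * (c • y) = c • (x * y) := by
  simp [mul_def]

protected lemma mul_assoc' (x y z : PathAlgebra k V) : x * y * z = x * (y * z) := by
  induction x using induction_path with
  | zero => simp [PathAlgebra.zero_mul']
  | add x x' h h' => simp [PathAlgebra.add_mul', h, h']
  | smul c x h => simp [PathAlgebra.smul_mul', h]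
  | path i j p =>
    induction y using induction_path with
    | zero => simp [PathAlgebra.zero_mul', PathAlgebra.mul_zero']
    | add x x' h h' => simp [PathAlgebra.add_mul', PathAlgebra.mul_add', h, h']
    | smul c x h => simp [PathAlgebra.smul_mul', PathAlgebra.mul_smul', h]
    | path i' j' p' =>
      induction z using induction_path with
      | zero => simp [PathAlgebra.mul_zero']
      | add x x' h h' => simp [PathAlgebra.mul_add', h, h']
      | smul c x h => simp [PathAlgebra.mul_smul', h]
      | path i'' j'' p'' =>
        by_cases h : j' = i
        · subst h
          by_cases h' : j'' = i'
          · subst h'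
            simp [ofPath_mul_ofPath, Quiver.Path.comp_assoc]
          · simp [ofPath_mul_ofPath, ofPath_mul_ofPath_of_ne _ _ h', PathAlgebra.mul_zero']
        · by_cases h' : j'' = i'
          · subst h'
            simp [ofPath_mul_ofPath, ofPath_mul_ofPath_of_ne _ _ h, PathAlgebra.zero_mul']
          · simp [ofPath_mul_ofPath_of_ne _ _ h', ofPath_mul_ofPath_of_ne _ _ h,
              PathAlgebra.mul_zero', PathAlgebra.zero_mul']

lemma sum_mul' {ι : Type u} (s : Finset ι) (f : ι → PathAlgebra k V) (x : PathAlgebra k V) :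
    (∑ i ∈ s, f i) * x = ∑ i ∈ s, f i * x := by
  simp [mul_def]

lemma mul_sum' {ι : Type u} (s : Finset ι) (f : ι → PathAlgebra k V) (x : PathAlgebra k V) :
    x * (∑ i ∈ s, f i) = ∑ i ∈ s, x * f i := by
  simp [mul_def]

protected lemma one_mul' [Finite V] (x : PathAlgebra k V) : 1 * x = x := by
  induction x using induction_path with
  | zero => simp [PathAlgebra.mul_zero']
  | add x x' h h' => simp [PathAlgebra.mul_add', h, h']
  | smul c x h => simp [PathAlgebra.mul_smul', h]
  | path i j p =>
    have := Fintype.ofFinite V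
    rw [one_def, sum_mul', Finset.sum_eq_single j]
    · simp [vertex, ofPath_mul_ofPath]
    · intro l _ hl
      exact ofPath_mul_ofPath_of_ne _ _ hl.symm
    · simp

protected lemma mul_one' [Finite V] (x : PathAlgebra k V) : x * 1 = x := by
  induction x using induction_path with
  | zero => simp [PathAlgebra.zero_mul']
  | add x x' h h' => simp [PathAlgebra.add_mul', h, h']
  | smul c x h => simp [PathAlgebra.smul_mul', h]
  | path i j p =>
    have := Fintype.ofFinite V
    rw [one_def, mul_sum', Finset.sum_eq_single i]
    · simp [vertex, ofPath_mul_ofPath]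
    · intro l _ hl
      exact ofPath_mul_ofPath_of_ne _ _ hl
    · simp

noncomputable instance [Finite V] : Ring (PathAlgebra k V) :=
  { (inferInstance : AddCommGroup (PathAlgebra k V)),
    (inferInstance : Mul (PathAlgebra k V)),
    (inferInstance : One (PathAlgebra k V)) with
    left_distrib := PathAlgebra.mul_add'
    right_distrib := PathAlgebra.add_mul'
    zero_mul := PathAlgebra.zero_mul'
    mul_zero := PathAlgebra.mul_zero'
    mul_assoc := PathAlgebra.mul_assoc'
    one_mul := PathAlgebra.one_mul'
    mul_one := PathAlgebra.mul_one' }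

noncomputable instance [Finite V] : Algebra k (PathAlgebra k V) :=
  Algebra.ofModule PathAlgebra.smul_mul' PathAlgebra.mul_smul'

lemma vertex_mul_self (i : V) : vertex k i * vertex k i = vertex k i := by
  simp [vertex, ofPath_mul_ofPath]

lemma vertex_mul_of_ne {i j : V} (h : i ≠ j) : vertex k i * vertex k j = 0 :=
  ofPath_mul_ofPath_of_ne _ _ h.symm

lemma vertex_mul_arrow {i j : V} (α : i ⟶ j) : vertex k j * arrow k α = arrow k α :=
  ofPath_mul_ofPath Quiver.Path.nil α.toPath

lemma arrow_mul_vertex {i j : V} (α : i ⟶ j) : arrow k α * vertex k i = arrow k α :=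
  (ofPath_mul_ofPath α.toPath Quiver.Path.nil).trans (by rw [Quiver.Path.nil_comp]; rfl)

end Basic

section Lift

variable {k : Type u} [Field k] {V : Type u} [Quiver.{u} V] {S : Type u} [Ring S] [Algebra k S]

/-- The value on a path, given values on trivial paths and on arrows. -/
def evalPath (f : V → S) (g : ∀ i j : V, (i ⟶ j) → S) {i : V} : ∀ {j : V}, Quiver.Path i j → S
  | _, .nil => f i
  | _, .cons p α => g _ _ α * evalPath f g p

variable (f : V → S) (g : ∀ i j : V, (i ⟶ j) → S)

lemma mul_evalPath (hf : ∀ i, f i * f i = f i) (hl : ∀ i j (α : i ⟶ j), f j * g i j α = g i j α)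
    {i j : V} (p : Quiver.Path i j) : f j * evalPath f g p = evalPath f g p := by
  cases p with
  | nil => exact hf i
  | cons p α => rw [evalPath, ← mul_assoc, hl]

lemma evalPath_mul (hf : ∀ i, f i * f i = f i) {i j : V} (p : Quiver.Path i j) :
    evalPath f g p * f i = evalPath f g p := by
  induction p with
  | nil => exact hf i
  | cons p α ih => rw [evalPath, mul_assoc, ih]

lemma evalPath_comp (hf : ∀ i, f i * f i = f i)
    (hl : ∀ i j (α : i ⟶ j), f j * g i j α = g i j α)
    {i j l : V} (p : Quiver.Path i j) (q : Quiver.Path j l) :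
    evalPath f g (p.comp q) = evalPath f g q * evalPath f g p := by
  induction q with
  | nil => exact (mul_evalPath f g hf hl p).symm
  | cons q α ih => rw [Quiver.Path.comp_cons, evalPath, ih, evalPath, mul_assoc]

/-- The universal property of the path algebra: an algebra map out of it is given by a complete
family of orthogonal idempotents (the images of the vertices) and compatible images of the
arrows. -/
noncomputable def lift [Finite V] (hf : ∀ i, f i * f i = f i)
    (hf' : ∀ i j, i ≠ j → f i * f j = 0)
    (hone : (letI := Fintype.ofFinite V; ∑ i : V, f i) = 1)
    (hl : ∀ i j (α : i ⟶ j), f j * g i j α = g i j α) : PathAlgebra k V →ₐ[k] S :=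
  AlgHom.ofLinearMap (linearLift k fun x => evalPath f g x.2.2)
    (by
      have := Fintype.ofFinite V
      rw [one_def, map_sum, ← hone]
      simp only [vertex, linearLift_ofPath, evalPath]
      congr!)
    (by
      intro x y
      induction x using induction_path with
      | zero => simp
      | add x x' h h' => simp [add_mul, h, h']
      | smul c x h => simp [h]
      | path i j p =>
        induction y using induction_path with
        | zero => simp
        | add x x' h h' => simp [mul_add, h, h']
        | smul c x h => simp [h]
        | path i' j' p' =>
          by_cases h : j' = i
          · subst h
            rw [ofPath_mul_ofPath]
            simp only [linearLift_ofPath]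
            exact evalPath_comp f g hf hl p' p
          · rw [ofPath_mul_ofPath_of_ne _ _ h]
            simp only [linearLift_ofPath, map_zero]
            rw [← evalPath_mul f g hf p, ← mul_evalPath f g hf hl p', mul_assoc,
              ← mul_assoc (f i), hf' i j' (Ne.symm h), zero_mul, mul_zero])

lemma lift_ofPath [Finite V] (hf : ∀ i, f i * f i = f i)
    (hf' : ∀ i j, i ≠ j → f i * f j = 0)
    (hone : (letI := Fintype.ofFinite V; ∑ i : V, f i) = 1)
    (hl : ∀ i j (α : i ⟶ j), f j * g i j α = g i j α) {i j : V} (p : Quiver.Path i j) :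
    lift (k := k) f g hf hf' hone hl (ofPath k p) = evalPath f g p :=
  linearLift_ofPath _ _

end Lift

section Map

variable (k : Type u) [Field k] {V W : Type u} [Quiver.{u} V] [Quiver.{u} W]

/-- The linear map of path algebras induced by a morphism of quivers (it sends a path to its
image). -/
noncomputable def map (F : V ⥤q W) : PathAlgebra k V →ₗ[k] PathAlgebra k W :=
  linearLift k fun x => ofPath k (F.mapPath x.2.2)

lemma map_ofPath (F : V ⥤q W) {i j : V} (p : Quiver.Path i j) :
    map k F (ofPath k p) = ofPath k (F.mapPath p) := linearLift_ofPath _ _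

end Map

end PathAlgebra

/-- A sink: no arrow starts at `a`. -/
def IsSink {V : Type u} [Quiver.{u} V] (a : V) : Prop := ∀ j : V, IsEmpty (a ⟶ j)

/-- A source: no arrow ends at `b`. -/
def IsSource {V : Type u} [Quiver.{u} V] (b : V) : Prop := ∀ j : V, IsEmpty (j ⟶ b)

/-- The algebra `k Q / R` of a quiver with relations. -/
abbrev QuiverAlgebra {k : Type u} [Field k] {V : Type u} [Quiver.{u} V] [Finite V]
    (R : TwoSidedIdeal (PathAlgebra k V)) : Type u :=
  R.ringCon.Quotient

/-! ### Sink-source gluing -/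

/-- The vertices of the glued quiver: the disjoint union of the vertices with `a` and `b`
identified. -/
def GluedVertex {VA VB : Type u} (a : VA) (b : VB) : Type u :=
  Quot fun x y : VA ⊕ VB => x = Sum.inl a ∧ y = Sum.inr b

namespace Gluing

section Quivers

variable {VA VB : Type u} (a : VA) (b : VB)

def inA (i : VA) : GluedVertex a b := Quot.mk _ (Sum.inl i)

def inB (j : VB) : GluedVertex a b := Quot.mk _ (Sum.inr j)

lemma inA_eq_inB : inA a b a = inB a b b := Quot.sound ⟨rfl, rfl⟩

instance [Finite VA] [Finite VB] : Finite (GluedVertex a b) := by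
  unfold GluedVertex; infer_instance

variable [Quiver.{u} VA] [Quiver.{u} VB]

/-- The arrows of the glued quiver: those of the first quiver and those of the second one. -/
inductive Arrow : GluedVertex a b → GluedVertex a b → Type u
  | left {i j : VA} (α : i ⟶ j) : Arrow (inA a b i) (inA a b j)
  | right {i j : VB} (β : i ⟶ j) : Arrow (inB a b i) (inB a b j)

instance : Quiver.{u} (GluedVertex a b) := ⟨Arrow a b⟩

/-- The inclusion of the quiver `Q_A`. -/
def inclA : VA ⥤q GluedVertex a b where
  obj := inA a b
  map α := Arrow.left α

/-- The inclusion of the quiver `Q_B`. -/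
def inclB : VB ⥤q GluedVertex a b where
  obj := inB a b
  map β := Arrow.right β

end Quivers

section Relations

variable {k : Type u} [Field k] {VA VB : Type u} [Quiver.{u} VA] [Quiver.{u} VB]
  [Finite VA] [Finite VB] (a : VA) (b : VB)

variable (k) in
/-- `e_A`, the sum of the idempotents of the vertices of `Q_A`. -/
noncomputable def eA : PathAlgebra k (GluedVertex a b) :=
  letI := Fintype.ofFinite VA; ∑ i : VA, PathAlgebra.vertex k (inA a b i)

variable (k) in
/-- `e_B`, the sum of the idempotents of the vertices of `Q_B`. -/
noncomputable def eB : PathAlgebra k (GluedVertex a b) :=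
  letI := Fintype.ofFinite VB; ∑ j : VB, PathAlgebra.vertex k (inB a b j)

/-- The relations of the glued algebra:
`⟨R_A + R_B + (1 - e_A) k Q (1 - e_B)⟩`. -/
noncomputable def relations (RA : TwoSidedIdeal (PathAlgebra k VA))
    (RB : TwoSidedIdeal (PathAlgebra k VB)) :
    TwoSidedIdeal (PathAlgebra k (GluedVertex a b)) :=
  TwoSidedIdeal.span
    (PathAlgebra.map k (inclA a b) '' (RA : Set (PathAlgebra k VA)) ∪
      PathAlgebra.map k (inclB a b) '' (RB : Set (PathAlgebra k VB)) ∪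
      Set.range fun x : PathAlgebra k (GluedVertex a b) => (1 - eA k a b) * x * (1 - eB k a b))

/-- The sink-source gluing `Λ = A Δ B = k Q_Λ / R_Λ` of `A = k Q_A / R_A` and `B = k Q_B / R_B`. -/
abbrev GluedAlgebra (RA : TwoSidedIdeal (PathAlgebra k VA)) (RB : TwoSidedIdeal (PathAlgebra k VB)) :
    Type u :=
  QuiverAlgebra (relations a b RA RB)

end Relations

/-! ### The projections `Λ → A` and `Λ → B` -/

section Projections

variable {k : Type u} [Field k] {VA VB : Type u} [Quiver.{u} VA] [Quiver.{u} VB]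
  [Finite VA] [Finite VB] (a : VA) (b : VB)

open PathAlgebra

open Classical in
variable (k) in
/-- Vertices of `Q_A` are kept, all other vertices are sent to zero. -/
noncomputable def vertexToA (x : GluedVertex a b) : PathAlgebra k VA :=
  Quot.lift (Sum.elim (fun i => vertex k i) fun j => if j = b then vertex k a else 0)
    (by rintro _ _ ⟨rfl, rfl⟩; simp) x

open Classical in
variable (k) in
/-- Vertices of `Q_B` are kept, all other vertices are sent to zero. -/
noncomputable def vertexToB (x : GluedVertex a b) : PathAlgebra k VB :=
  Quot.lift (Sum.elim (fun i => if i = a then vertex k b else 0) fun j => vertex k j)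
    (by rintro _ _ ⟨rfl, rfl⟩; simp) x

variable (k) in
/-- Arrows of `Q_A` are kept, arrows of `Q_B` are sent to zero. -/
noncomputable def arrowToA : ∀ x y : GluedVertex a b, (x ⟶ y) → PathAlgebra k VA
  | _, _, Arrow.left α => arrow k α
  | _, _, Arrow.right _ => 0

variable (k) in
/-- Arrows of `Q_B` are kept, arrows of `Q_A` are sent to zero. -/
noncomputable def arrowToB : ∀ x y : GluedVertex a b, (x ⟶ y) → PathAlgebra k VB
  | _, _, Arrow.left _ => 0
  | _, _, Arrow.right β => arrow k β

open Classical in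
lemma inA_injective : Function.Injective (inA a b) := by
  let r : GluedVertex a b → Option VA :=
    Quot.lift (Sum.elim some fun j => if j = b then some a else none)
      (by rintro _ _ ⟨rfl, rfl⟩; simp)
  intro i j h
  exact Option.some_injective _ (congrArg r h)

open Classical in
lemma inB_injective : Function.Injective (inB a b) := by
  let r : GluedVertex a b → Option VB :=
    Quot.lift (Sum.elim (fun i => if i = a then some b else none) some)
      (by rintro _ _ ⟨rfl, rfl⟩; simp)
  intro i j h
  exact Option.some_injective _ (congrArg r h)

lemma vertexToA_inA (i : VA) : vertexToA k a b (inA a b i) = vertex k i := rfl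

lemma vertexToB_inB (j : VB) : vertexToB k a b (inB a b j) = vertex k j := rfl

lemma vertexToA_inB (j : VB) (h : j ≠ b) : vertexToA k a b (inB a b j) = 0 := if_neg h

lemma vertexToB_inA (i : VA) (h : i ≠ a) : vertexToB k a b (inA a b i) = 0 := if_neg h

lemma cases_A (x : GluedVertex a b) : (∃ i, x = inA a b i) ∨ ∃ j, j ≠ b ∧ x = inB a b j := by
  induction x using Quot.ind with
  | mk x =>
    rcases x with i | j
    · exact Or.inl ⟨i, rfl⟩
    · by_cases h : j = b
      · subst h; exact Or.inl ⟨a, (inA_eq_inB a j).symm⟩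
      · exact Or.inr ⟨j, h, rfl⟩

lemma cases_B (x : GluedVertex a b) : (∃ j, x = inB a b j) ∨ ∃ i, i ≠ a ∧ x = inA a b i := by
  induction x using Quot.ind with
  | mk x =>
    rcases x with i | j
    · by_cases h : i = a
      · subst h; exact Or.inl ⟨b, inA_eq_inB i b⟩
      · exact Or.inr ⟨i, h, rfl⟩
    · exact Or.inl ⟨j, rfl⟩

variable (k) in
/-- The algebra map `k Q_Λ → k Q_A` which is the identity on the paths of `Q_A` and sends all other
paths to zero. -/
noncomputable def pathToA : PathAlgebra k (GluedVertex a b) →ₐ[k] PathAlgebra k VA :=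
  lift (vertexToA k a b) (arrowToA k a b)
    (by
      intro x
      rcases cases_A a b x with ⟨i, rfl⟩ | ⟨j, hj, rfl⟩
      · simp [vertexToA_inA, vertex_mul_self]
      · simp [vertexToA_inB _ _ _ hj])
    (by
      intro x y h
      rcases cases_A a b x with ⟨i, rfl⟩ | ⟨j, hj, rfl⟩
      · rcases cases_A a b y with ⟨i', rfl⟩ | ⟨j', hj', rfl⟩
        · rw [vertexToA_inA, vertexToA_inA]
          exact vertex_mul_of_ne fun e => h (congrArg _ e)
        · simp [vertexToA_inB _ _ _ hj']
      · simp [vertexToA_inB _ _ _ hj])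
    (by
      let := Fintype.ofFinite VA
      let := Fintype.ofFinite (GluedVertex a b)
      rw [one_def]
      refine (Fintype.sum_of_injective (inA a b) (inA_injective a b) _ _ ?_ ?_).symm
      · intro x hx
        rcases cases_A a b x with ⟨i, rfl⟩ | ⟨j, hj, rfl⟩
        · exact absurd ⟨i, rfl⟩ hx
        · exact vertexToA_inB _ _ _ hj
      · intro i; rfl)
    (by
      rintro _ _ (α | β)
      · exact vertex_mul_arrow α
      · exact mul_zero _)

variable (k) in
/-- The algebra map `k Q_Λ → k Q_B` which is the identity on the paths of `Q_B` and sends all other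
paths to zero. -/
noncomputable def pathToB : PathAlgebra k (GluedVertex a b) →ₐ[k] PathAlgebra k VB :=
  lift (vertexToB k a b) (arrowToB k a b)
    (by
      intro x
      rcases cases_B a b x with ⟨i, rfl⟩ | ⟨j, hj, rfl⟩
      · simp [vertexToB_inB, vertex_mul_self]
      · simp [vertexToB_inA _ _ _ hj])
    (by
      intro x y h
      rcases cases_B a b x with ⟨i, rfl⟩ | ⟨j, hj, rfl⟩
      · rcases cases_B a b y with ⟨i', rfl⟩ | ⟨j', hj', rfl⟩
        · rw [vertexToB_inB, vertexToB_inB]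
          exact vertex_mul_of_ne fun e => h (congrArg _ e)
        · simp [vertexToB_inA _ _ _ hj']
      · simp [vertexToB_inA _ _ _ hj])
    (by
      let := Fintype.ofFinite VB
      let := Fintype.ofFinite (GluedVertex a b)
      rw [one_def]
      refine (Fintype.sum_of_injective (inB a b) (inB_injective a b) _ _ ?_ ?_).symm
      · intro x hx
        rcases cases_B a b x with ⟨i, rfl⟩ | ⟨j, hj, rfl⟩
        · exact absurd ⟨i, rfl⟩ hx
        · exact vertexToB_inA _ _ _ hj
      · intro i; rfl)
    (by
      rintro _ _ (α | β)
      · exact mul_zero _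
      · exact vertex_mul_arrow β)

lemma pathToA_eA : pathToA k a b (eA k a b) = 1 := by
  let := Fintype.ofFinite VA
  unfold eA
  rw [one_def, map_sum]
  congr! 1 with i
  exact lift_ofPath _ _ _ _ _ _ _

lemma pathToB_eB : pathToB k a b (eB k a b) = 1 := by
  let := Fintype.ofFinite VB
  unfold eB
  rw [one_def, map_sum]
  congr! 1 with i
  exact lift_ofPath _ _ _ _ _ _ _

lemma pathToA_map_inclA (x : PathAlgebra k VA) :
    pathToA k a b (PathAlgebra.map k (inclA a b) x) = x := by
  induction x using induction_path with
  | zero => simp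
  | add x y hx hy => simp [hx, hy]
  | smul c x hx => simp [hx]
  | path i j p =>
    rw [map_ofPath]
    refine (lift_ofPath _ _ _ _ _ _ _).trans ?_
    induction p with
    | nil => rfl
    | cons p α ih =>
      rw [Prefunctor.mapPath_cons, evalPath, ih]
      exact ofPath_mul_ofPath α.toPath p

lemma pathToB_map_inclB (x : PathAlgebra k VB) :
    pathToB k a b (PathAlgebra.map k (inclB a b) x) = x := by
  induction x using induction_path with
  | zero => simp
  | add x y hx hy => simp [hx, hy]
  | smul c x hx => simp [hx]
  | path i j p =>
    rw [map_ofPath]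
    refine (lift_ofPath _ _ _ _ _ _ _).trans ?_
    induction p with
    | nil => rfl
    | cons p α ih =>
      rw [Prefunctor.mapPath_cons, evalPath, ih]
      exact ofPath_mul_ofPath α.toPath p

lemma evalPath_A_inclB {i j : VB} (p : Quiver.Path i j) (hp : p.length ≠ 0) :
    evalPath (vertexToA k a b) (arrowToA k a b) ((inclB a b).mapPath p) = 0 := by
  cases p with
  | nil => simp at hp
  | cons p β => exact zero_mul _

lemma evalPath_B_inclA {i j : VA} (p : Quiver.Path i j) (hp : p.length ≠ 0) :
    evalPath (vertexToB k a b) (arrowToB k a b) ((inclA a b).mapPath p) = 0 := by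
  cases p with
  | nil => simp at hp
  | cons p β => exact zero_mul _

lemma length_eq_zero_of_isSource {V : Type u} [Quiver.{u} V] {v : V} (h : IsSource v) {i : V}
    (p : Quiver.Path i v) : p.length = 0 := by
  cases p with
  | nil => rfl
  | cons p α => exact ((h _).false α).elim

lemma length_eq_zero_of_isSink {V : Type u} [Quiver.{u} V] {v : V} (h : IsSink v) {j : V}
    (p : Quiver.Path v j) : p.length = 0 := by
  induction p with
  | nil => rfl
  | cons p α ih =>
    obtain rfl := Quiver.Path.eq_of_length_zero p ih
    exact ((h _).false α).elim

/-- At a source or a sink `v`, the corner `e_v (k Q) e_v` is spanned by `e_v`; hence an ideal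
not containing `e_v` meets that corner trivially. -/
lemma vertex_mul_mul_vertex_eq_zero {V : Type u} [Quiver.{u} V] [Finite V] {v : V}
    (hv : ∀ p : Quiver.Path v v, p.length = 0) (R : TwoSidedIdeal (PathAlgebra k V))
    (hR : vertex k v ∉ R) {r : PathAlgebra k V} (hr : r ∈ R) :
    vertex k v * r * vertex k v = 0 := by
  have key : ∀ x : PathAlgebra k V, ∃ c : k, vertex k v * x * vertex k v = c • vertex k v := by
    intro x
    induction x using induction_path with
    | zero => exact ⟨0, by simp⟩
    | add x y hx hy =>
      obtain ⟨c, hc⟩ := hx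
      obtain ⟨d, hd⟩ := hy
      exact ⟨c + d, by rw [mul_add, add_mul, hc, hd, add_smul]⟩
    | smul c x hx =>
      obtain ⟨d, hd⟩ := hx
      exact ⟨c * d, by simp [hd, mul_smul]⟩
    | path i j p =>
      by_cases hj : j = v
      · by_cases hi : i = v
        · subst hj; subst hi
          obtain rfl := Quiver.Path.eq_nil_of_length_zero p (hv p)
          exact ⟨1, by
            rw [one_smul]
            change vertex k i * vertex k i * vertex k i = _
            rw [vertex_mul_self, vertex_mul_self]⟩
        · refine ⟨0, ?_⟩
          rw [mul_assoc, vertex, ofPath_mul_ofPath_of_ne p _ (Ne.symm hi), mul_zero, zero_smul]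
      · refine ⟨0, ?_⟩
        rw [vertex, ofPath_mul_ofPath_of_ne _ p hj, zero_mul, zero_smul]
  obtain ⟨c, hc⟩ := key r
  by_cases h0 : c = 0
  · rw [hc, h0, zero_smul]
  · exfalso
    apply hR
    have h1 : vertex k v * r * vertex k v ∈ R := R.mul_mem_right _ _ (R.mul_mem_left _ _ hr)
    have h2 := R.mul_mem_left (algebraMap k _ c⁻¹) _ h1
    rwa [hc, ← Algebra.smul_def, smul_smul, inv_mul_cancel₀ h0, one_smul] at h2

lemma pathToA_map_inclB (hb : IsSource b) (x : PathAlgebra k VB) :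
    pathToA k a b (PathAlgebra.map k (inclB a b) x) =
      pathToA k a b (PathAlgebra.map k (inclB a b) (vertex k b * x * vertex k b)) := by
  induction x using induction_path with
  | zero => simp
  | add x y hx hy => simp only [mul_add, add_mul, map_add, hx, hy]
  | smul c x hx => simp [hx]
  | path i j p =>
    have hz : p.length ≠ 0 ∨ ∃ h : i = j, p = h ▸ Quiver.Path.nil := by
      cases p with
      | nil => exact Or.inr ⟨rfl, rfl⟩
      | cons p β => exact Or.inl (by simp)
    rcases hz with hz | ⟨rfl, rfl⟩
    · rw [map_ofPath]
      refine (lift_ofPath _ _ _ _ _ _ _).trans ?_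
      rw [evalPath_A_inclB a b p hz]
      by_cases hj : j = b
      · subst hj; exact absurd (length_eq_zero_of_isSource hb p) hz
      · rw [vertex, ofPath_mul_ofPath_of_ne _ p hj]; simp
    · change pathToA k a b (PathAlgebra.map k (inclB a b) (vertex k i)) =
        pathToA k a b (PathAlgebra.map k (inclB a b) (vertex k b * vertex k i * vertex k b))
      by_cases hi : i = b
      · subst hi; rw [vertex_mul_self, vertex_mul_self]
      · rw [vertex_mul_of_ne (Ne.symm hi), zero_mul, map_zero, map_zero, vertex, map_ofPath]
        exact (lift_ofPath _ _ _ _ _ _ _).trans (vertexToA_inB a b i hi)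

lemma pathToB_map_inclA (ha : IsSink a) (x : PathAlgebra k VA) :
    pathToB k a b (PathAlgebra.map k (inclA a b) x) =
      pathToB k a b (PathAlgebra.map k (inclA a b) (vertex k a * x * vertex k a)) := by
  induction x using induction_path with
  | zero => simp
  | add x y hx hy => simp only [mul_add, add_mul, map_add, hx, hy]
  | smul c x hx => simp [hx]
  | path i j p =>
    have hz : p.length ≠ 0 ∨ ∃ h : i = j, p = h ▸ Quiver.Path.nil := by
      cases p with
      | nil => exact Or.inr ⟨rfl, rfl⟩
      | cons p β => exact Or.inl (by simp)
    rcases hz with hz | ⟨rfl, rfl⟩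
    · rw [map_ofPath]
      refine (lift_ofPath _ _ _ _ _ _ _).trans ?_
      rw [evalPath_B_inclA a b p hz]
      by_cases hi : i = a
      · subst hi; exact absurd (length_eq_zero_of_isSink ha p) hz
      · rw [mul_assoc, vertex, ofPath_mul_ofPath_of_ne p _ (Ne.symm hi)]; simp
    · change pathToB k a b (PathAlgebra.map k (inclA a b) (vertex k i)) =
        pathToB k a b (PathAlgebra.map k (inclA a b) (vertex k a * vertex k i * vertex k a))
      by_cases hi : i = a
      · subst hi; rw [vertex_mul_self, vertex_mul_self]
      · rw [vertex_mul_of_ne (Ne.symm hi), zero_mul, map_zero, map_zero, vertex, map_ofPath]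
        exact (lift_ofPath _ _ _ _ _ _ _).trans (vertexToB_inA a b i hi)

variable {a b} (RA : TwoSidedIdeal (PathAlgebra k VA)) (RB : TwoSidedIdeal (PathAlgebra k VB))

lemma relations_le_A (hb : IsSource b) (heb : vertex k b ∉ RB) :
    relations a b RA RB ≤ RA.comap (pathToA k a b) := by
  unfold relations
  rw [TwoSidedIdeal.span_le]
  rintro _ ((⟨x, hx, rfl⟩ | ⟨x, hx, rfl⟩) | ⟨x, rfl⟩)
  · rw [SetLike.mem_coe, TwoSidedIdeal.mem_comap, pathToA_map_inclA]
    exact hx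
  · rw [SetLike.mem_coe, TwoSidedIdeal.mem_comap, pathToA_map_inclB a b hb,
      vertex_mul_mul_vertex_eq_zero (length_eq_zero_of_isSource hb) RB heb hx, map_zero, map_zero]
    exact RA.zero_mem
  · rw [SetLike.mem_coe, TwoSidedIdeal.mem_comap]
    simp only [map_mul, map_sub, map_one, pathToA_eA, sub_self, zero_mul]
    exact RA.zero_mem

lemma relations_le_B (ha : IsSink a) (hea : vertex k a ∉ RA) :
    relations a b RA RB ≤ RB.comap (pathToB k a b) := by
  unfold relations
  rw [TwoSidedIdeal.span_le]
  rintro _ ((⟨x, hx, rfl⟩ | ⟨x, hx, rfl⟩) | ⟨x, rfl⟩)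
  · rw [SetLike.mem_coe, TwoSidedIdeal.mem_comap, pathToB_map_inclA a b ha,
      vertex_mul_mul_vertex_eq_zero (length_eq_zero_of_isSink ha) RA hea hx, map_zero, map_zero]
    exact RB.zero_mem
  · rw [SetLike.mem_coe, TwoSidedIdeal.mem_comap, pathToB_map_inclB]
    exact hx
  · rw [SetLike.mem_coe, TwoSidedIdeal.mem_comap]
    simp only [map_mul, map_sub, map_one, pathToB_eB, sub_self, mul_zero]
    exact RB.zero_mem

/-- The projection `π_A : Λ → A`, induced by the map `k Q_Λ → k Q_A` that is the identity on the
paths of `Q_A` and kills all other paths. -/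
noncomputable def projA (hb : IsSource b) (heb : vertex k b ∉ RB) :
    Gluing.GluedAlgebra a b RA RB →+* QuiverAlgebra RA :=
  (relations a b RA RB).ringCon.lift (RA.ringCon.mk'.comp (pathToA k a b : _ →+* _)) (by
    intro x y h
    rw [TwoSidedIdeal.rel_iff] at h
    have h' := relations_le_A RA RB hb heb h
    rw [TwoSidedIdeal.mem_comap, map_sub] at h'
    exact (RingCon.eq _).2 ((TwoSidedIdeal.rel_iff _ _ _).2 h'))

/-- The projection `π_B : Λ → B`, induced by the map `k Q_Λ → k Q_B` that is the identity on the
paths of `Q_B` and kills all other paths. -/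
noncomputable def projB (ha : IsSink a) (hea : vertex k a ∉ RA) :
    Gluing.GluedAlgebra a b RA RB →+* QuiverAlgebra RB :=
  (relations a b RA RB).ringCon.lift (RB.ringCon.mk'.comp (pathToB k a b : _ →+* _)) (by
    intro x y h
    rw [TwoSidedIdeal.rel_iff] at h
    have h' := relations_le_B RA RB ha hea h
    rw [TwoSidedIdeal.mem_comap, map_sub] at h'
    exact (RingCon.eq _).2 ((TwoSidedIdeal.rel_iff _ _ _).2 h'))

end Projections

end Gluing

/-! ### Right modules, cluster tilting subcategories -/

/-- The category of right `A`-modules. -/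
abbrev RightMod (A : Type u) [Ring A] : Type (u + 1) := ModuleCat.{u} Aᵐᵒᵖ

/-- `mod A`: the finitely generated right `A`-modules. -/
def fgMod (A : Type u) [Ring A] : ObjectProperty (RightMod A) := fun X => Module.Finite Aᵐᵒᵖ X

/-- `Ext^i_A(X, Y) = 0` for all `0 < i < d`. -/
def ExtVanishes {A : Type u} [Ring A] (d : ℕ) (X Y : RightMod A) : Prop :=
  ∀ i : ℕ, 0 < i → i < d → Subsingleton (Abelian.Ext X Y i)

/-- `M` is a `d`-cluster tilting subcategory of `mod A`.  Full subcategories are given by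
properties of objects. -/
structure IsClusterTilting {A : Type u} [Ring A] (d : ℕ) (M : ObjectProperty (RightMod A)) :
    Prop where
  /-- `M` is a subcategory of `mod A`. -/
  le_fgMod : M ≤ fgMod A
  /-- Every object of `mod A` has a right `M`-approximation. -/
  contravariantlyFinite : ∀ C, fgMod A C → ∃ (X : RightMod A) (f : X ⟶ C), M X ∧
    ∀ (X' : RightMod A) (g : X' ⟶ C), M X' → ∃ h : X' ⟶ X, h ≫ f = g
  /-- Every object of `mod A` has a left `M`-approximation. -/
  covariantlyFinite : ∀ C, fgMod A C → ∃ (X : RightMod A) (f : C ⟶ X), M X ∧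
    ∀ (X' : RightMod A) (g : C ⟶ X'), M X' → ∃ h : X ⟶ X', f ≫ h = g
  generating : ∀ C, fgMod A C → ∃ (X : RightMod A) (f : X ⟶ C), M X ∧ Epi f
  cogenerating : ∀ C, fgMod A C → ∃ (X : RightMod A) (f : C ⟶ X), M X ∧ Mono f
  /-- `M = {C ∈ mod A | Ext^i(C, M) = 0 for 1 ≤ i ≤ d - 1}`. -/
  eq_left : ∀ C, M C ↔ fgMod A C ∧ ∀ Y, M Y → ExtVanishes d C Y
  /-- `M = {C ∈ mod A | Ext^i(M, C) = 0 for 1 ≤ i ≤ d - 1}`. -/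
  eq_right : ∀ C, M C ↔ fgMod A C ∧ ∀ Y, M Y → ExtVanishes d Y C

/-- `M` is a `dℤ`-cluster tilting subcategory of `mod A`: it is `d`-cluster tilting, and
`Ext^i(M, M) ≠ 0` implies `i ∈ dℤ`. -/
structure IsZClusterTilting {A : Type u} [Ring A] (d : ℕ) (M : ObjectProperty (RightMod A)) :
    Prop extends IsClusterTilting d M where
  dvd_of_ext_ne_zero : ∀ X Y, M X → M Y → ∀ i : ℕ, ¬ Subsingleton (Abelian.Ext X Y i) → d ∣ i

/-- `add P`: the direct summands of finite direct sums of objects of `P`. -/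
def addClosure {A : Type u} [Ring A] (P : ObjectProperty (RightMod A)) :
    ObjectProperty (RightMod A) :=
  fun X => ∃ (n : ℕ) (Y : Fin n → RightMod A), (∀ i, P (Y i)) ∧ Nonempty (Retract X (⨁ Y))

/-- The embedding `mod A → mod A'` given by restriction of scalars along a ring map `A' → A`. -/
noncomputable abbrev inflation {A A' : Type u} [Ring A] [Ring A'] (π : A' →+* A) :
    RightMod A ⥤ RightMod A' :=
  ModuleCat.restrictScalars (RingHom.op π)

/-- The gluing `M_A Δ_S M_B = add {M_A, M_B} ⊆ mod Λ`, where `M_A` and `M_B` are identified with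
their (essential) images under the embeddings `mod A → mod Λ` and `mod B → mod Λ`. -/
noncomputable def gluedSubcategory {k : Type u} [Field k] {VA VB : Type u} [Quiver.{u} VA]
    [Quiver.{u} VB] [Finite VA] [Finite VB] {a : VA} {b : VB}
    (RA : TwoSidedIdeal (PathAlgebra k VA)) (RB : TwoSidedIdeal (PathAlgebra k VB))
    (ha : IsSink a) (hb : IsSource b)
    (hea : PathAlgebra.vertex k a ∉ RA) (heb : PathAlgebra.vertex k b ∉ RB)
    (MA : ObjectProperty (RightMod (QuiverAlgebra RA)))
    (MB : ObjectProperty (RightMod (QuiverAlgebra RB))) :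
    ObjectProperty (RightMod (Gluing.GluedAlgebra a b RA RB)) :=
  addClosure (MA.map (inflation (Gluing.projA RA RB hb heb)) ⊔
    MB.map (inflation (Gluing.projB RA RB ha hea)))

/-! ### Restriction of scalars along a surjective ring homomorphism -/

namespace ModuleCat

section RestrictScalars

variable {R S : Type u} [Ring R] [Ring S] (φ : R →+* S)

/-! Right `Λ`-modules are left modules over `R = Λᵐᵒᵖ`. Let `f₁`, `f₂` be the opposites of `1 -
e_A`, `1 - e_B`, and `s = 1 - f₁ - f₂`, the idempotent of the glued vertex. The modules killed by
`f₁` are the `A`-modules, those killed by `f₂` are the `B`-modules, and those killed by both are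
vector spaces placed at the glued vertex. Everything follows from the properties collected in
`IsIdempotentGluing`.

A module consists of `f₁X`, `sX`, `f₂X`, with action maps going only from left to right, and `f₂ R
f₁ = 0`. The part of `sX` generated by `f₁X` is therefore annihilated on its way to `f₂X`; a linear
complement of it splits `X` into an `A`-module and a `B`-module (`exists_iso_biprod`).

Inflation from `A` preserves projectives and inflation from `B` preserves injectives, because the
kernels are `R f₁` and `f₂ R`. Hence both are exact, fully faithful and preserve `Ext`. Positive
`Ext` from an `A`-module to a `B`-module vanishes (`subsingleton_ext_succ`). Consequently a module
`T` killed by both idempotents has no positive `Ext` into it over `A` nor out of it over `B`, so if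
finitely generated it lies in both cluster tilting subcategories.

The remaining direction, `Ext^i` from a `B`-module `Y` to an `A`-module `X`, is controlled by
`subsingleton_ext`: besides `Ext^i(Y, T) = 0`, it suffices that for each splitting `i = j + l` one
of `Ext^j(Y, T)`, `Ext^l(T, X)` vanishes for all such `T`. Both degree sets in question, `0 < i < d`
and `d ∤ i`, contain a summand of each splitting of their members, so a single argument serves both
claims. Approximations are glued summandwise, since a morphism between an `A`-module and a
`B`-module factors through its image, which is killed by both idempotents. -/

lemma preservesFiniteLimits_and_colimits_restrictScalars :
    PreservesFiniteLimits (restrictScalars.{u} φ) ∧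
      PreservesFiniteColimits (restrictScalars.{u} φ) := by
  refine ((Functor.exact_tfae (restrictScalars.{u} φ)).out 1 3).mp fun T hT => ?_
  rw [ShortComplex.ShortExact.moduleCat_exact_iff_function_exact] at hT ⊢
  exact hT

instance preservesFiniteLimits_restrictScalars :
    PreservesFiniteLimits (restrictScalars.{u} φ) :=
  (preservesFiniteLimits_and_colimits_restrictScalars φ).1

instance preservesFiniteColimits_restrictScalars :
    PreservesFiniteColimits (restrictScalars.{u} φ) :=
  (preservesFiniteLimits_and_colimits_restrictScalars φ).2

variable {φ} (hφ : Function.Surjective φ)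

include hφ in
lemma full_restrictScalars : (restrictScalars.{u} φ).Full where
  map_surjective {X Y} f := by
    refine ⟨ofHom { toFun := f.hom, map_add' := f.hom.map_add, map_smul' := ?_ }, rfl⟩
    intro s x
    obtain ⟨r, rfl⟩ := hφ s
    exact f.hom.map_smul r x

include hφ in
/-- A module killed by the kernel of a surjective ring homomorphism is obtained by restriction
of scalars. -/
lemma exists_restrictScalars_obj_iso (X : ModuleCat.{u} R)
    (hX : ∀ r, φ r = 0 → ∀ x : X, r • x = 0) :
    ∃ Y : ModuleCat.{u} S, Nonempty ((restrictScalars.{u} φ).obj Y ≅ X) := by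
  let : SMul S X := ⟨fun s x => Function.surjInv hφ s • x⟩
  have hsmul : ∀ (r : R) (x : X), φ r • x = r • x := by
    intro r x
    have : (Function.surjInv hφ (φ r) - r) • x = 0 :=
      hX _ (by rw [map_sub, Function.surjInv_eq hφ, sub_self]) x
    rwa [sub_smul, sub_eq_zero] at this
  let : Module S X := hφ.moduleLeft φ hsmul
  let Z : ModuleCat.{u} R := (restrictScalars.{u} φ).obj (of S X)
  let e : Z ≃ₗ[R] X := { AddEquiv.refl X with map_smul' := fun r x => hsmul r x }
  exact ⟨of S X, ⟨e.toModuleIso⟩⟩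

lemma smul_restrictScalars_obj_eq_zero {r : R} (hr : φ r = 0) (Y : ModuleCat.{u} S)
    (x : (restrictScalars.{u} φ).obj Y) : r • x = 0 := by
  rw [restrictScalars.smul_def, hr]
  exact zero_smul S (show Y from x)

include hφ in
-- Surjectivity makes the `R`-span and the `S`-span of a set coincide, so the same generators work
-- on both sides.
lemma finite_restrictScalars_obj_iff (Y : ModuleCat.{u} S) :
    Module.Finite R ((restrictScalars.{u} φ).obj Y) ↔ Module.Finite S Y := by
  have : RingHomSurjective φ := ⟨hφ⟩
  let e : (restrictScalars.{u} φ).obj Y →ₛₗ[φ] Y :=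
    { toFun := fun y => y, map_add' := fun _ _ => rfl, map_smul' := fun _ _ => rfl }
  constructor
  · intro h
    exact Module.Finite.of_surjective e fun y => ⟨y, rfl⟩
  · rintro ⟨s, hs⟩
    refine ⟨s, ?_⟩
    rw [eq_top_iff]
    rintro y -
    have hy : (y : Y) ∈ Submodule.span S (s : Set Y) := by rw [hs]; trivial
    induction hy using Submodule.span_induction with
    | mem x hx => exact Submodule.subset_span hx
    | zero => exact Submodule.zero_mem _
    | add x y _ _ hx hy => exact Submodule.add_mem _ hx hy
    | smul a x _ hx =>
      obtain ⟨r, rfl⟩ := hφ a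
      exact Submodule.smul_mem _ r hx

/-- If the kernel of `φ : R → S` is `R f` for an idempotent `f`, then restriction of scalars
along `φ` preserves projective objects. -/
lemma preservesProjectiveObjects_restrictScalars (hφ : Function.Surjective φ) {f : R}
    (hf : f * f = f) (hker : ∀ r, φ r = 0 ↔ r * f = r) :
    (restrictScalars.{u} φ).PreservesProjectiveObjects := by
  have hproj : Module.Projective R ((restrictScalars.{u} φ).obj (of S S)) := by
    -- Multiplication by `1 - f` forgets the choice of lift along `φ`. This makes `S` a direct
    -- summand of `R`, isomorphic to `R (1 - f)`.
    have hi : ∀ x y : R, φ x = φ y → x * (1 - f) = y * (1 - f) := by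
      intro x y h
      have h' := (hker (x - y)).1 (by rw [map_sub, h, sub_self])
      rw [← sub_eq_zero, ← sub_mul, mul_sub, h', mul_one, sub_self]
    have hf1 : φ f = 0 := (hker f).2 hf
    let i : (restrictScalars.{u} φ).obj (of S S) →ₗ[R] R :=
      { toFun := fun s => Function.surjInv hφ (show S from s) * (1 - f)
        map_add' := by
          intro x y
          rw [← add_mul]
          apply hi
          rw [map_add]
          exact (Function.surjInv_eq hφ _).trans (congrArg₂ (· + ·)
            (Function.surjInv_eq hφ _).symm (Function.surjInv_eq hφ _).symm)
        map_smul' := by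
          intro r x
          rw [RingHom.id_apply, smul_eq_mul, ← mul_assoc]
          apply hi
          rw [map_mul]
          exact (Function.surjInv_eq hφ _).trans
            (congrArg (φ r * ·) (Function.surjInv_eq hφ _).symm) }
    let p : R →ₗ[R] (restrictScalars.{u} φ).obj (of S S) :=
      { toFun := fun r => φ r
        map_add' := map_add φ
        map_smul' := map_mul φ }
    refine Module.Projective.of_split i p ?_
    ext s
    change φ (Function.surjInv hφ (show S from s) * (1 - f)) = s
    rw [map_mul, Function.surjInv_eq hφ, map_sub, map_one, hf1, sub_zero, mul_one]
  -- Coextension is `Hom_R(S, -)`, which preserves surjections as `S` is `R`-projective; its left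
  -- adjoint, restriction, then preserves projectives.
  have : (coextendScalars.{u, u, u} φ).PreservesEpimorphisms := by
    refine ⟨fun {X Y} q hq => ?_⟩
    rw [epi_iff_surjective] at hq ⊢
    intro g
    obtain ⟨h, hh⟩ := Module.projective_lifting_property q.hom g hq
    exact ⟨h, hh⟩
  exact Functor.preservesProjectiveObjects_of_adjunction_of_preservesEpimorphisms
    (restrictCoextendScalarsAdj.{u, u, u} φ)

/-- If the kernel of `φ : R → S` is `f R` for an idempotent `f`, then restriction of scalars
along `φ` preserves injective objects. -/
lemma preservesInjectiveObjects_restrictScalars (hφ : Function.Surjective φ) {f : R}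
    (hf : f * f = f) (hker : ∀ r, φ r = 0 ↔ f * r = r) :
    (restrictScalars.{u} φ).PreservesInjectiveObjects := by
  have := full_restrictScalars hφ
  have hmul : ∀ r, r * f = f * (r * f) := fun r =>
    ((hker _).1 (by rw [map_mul, (hker f).2 hf, mul_zero])).symm
  refine ⟨fun {J} hJ => ⟨fun {X Y} g i hi => ?_⟩⟩
  rw [mono_iff_injective] at hi
  -- This is `f Z`, a submodule because `r f = f r f`. The quotient `Z / f Z` is an `S`-module
  -- through which every map from `Z` to a module killed by `f` factors.
  let N (Z : ModuleCat.{u} R) : Submodule R Z :=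
    { carrier := {z | f • z = z}
      add_mem' := fun {a b} ha hb => by rw [Set.mem_ofPred_eq] at *; rw [smul_add, ha, hb]
      zero_mem' := smul_zero _
      smul_mem' := fun r z hz => by
        rw [Set.mem_ofPred_eq] at *
        rw [← hz, ← mul_smul r f, hmul r, ← mul_smul f, ← mul_assoc f f, hf] }
  have hN : ∀ Z : ModuleCat.{u} R, ∃ Z' : ModuleCat.{u} S,
      Nonempty ((restrictScalars.{u} φ).obj Z' ≅ of R (Z ⧸ N Z)) := by
    intro Z
    refine exists_restrictScalars_obj_iso hφ _ fun r hr x => ?_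
    obtain ⟨z, rfl⟩ := Submodule.Quotient.mk_surjective _ x
    rw [← Submodule.Quotient.mk_smul, Submodule.Quotient.mk_eq_zero]
    change f • r • z = r • z
    rw [← mul_smul, (hker r).1 hr]
  obtain ⟨X', ⟨eX⟩⟩ := hN X
  obtain ⟨Y', ⟨eY⟩⟩ := hN Y
  have hle : N X ≤ (N Y).comap i.hom := fun x hx => by
    change f • i.hom x = i.hom x
    rw [← map_smul, show f • x = x from hx]
  let i' : of R (X ⧸ N X) ⟶ of R (Y ⧸ N Y) := ofHom (Submodule.mapQ _ _ i.hom hle)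
  -- If `f (i x) = i x`, injectivity of `i` gives `f x = x`; thus `Z ↦ Z / f Z` preserves
  -- monomorphisms, and the extension problem moves to `S`-modules.
  have hi' : Mono i' := by
    rw [mono_iff_injective]
    refine (injective_iff_map_eq_zero i'.hom).2 fun x hx => ?_
    obtain ⟨x, rfl⟩ := Submodule.Quotient.mk_surjective _ x
    change Submodule.Quotient.mk (i.hom x) = 0 at hx
    rw [Submodule.Quotient.mk_eq_zero] at hx ⊢
    apply hi
    change i.hom (f • x) = i.hom x
    rw [map_smul]
    exact hx
  have hg : ∀ (Z : ModuleCat.{u} R) (g : X ⟶ Z), (∀ z : Z, f • z = 0) →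
      ∃ g' : of R (X ⧸ N X) ⟶ Z, ofHom (N X).mkQ ≫ g' = g := fun Z g hZ =>
    ⟨ofHom ((N X).liftQ g.hom fun x hx => by
      rw [LinearMap.mem_ker, ← show f • x = x from hx, map_smul, hZ]), rfl⟩
  obtain ⟨g', hg'⟩ := hg _ g (smul_restrictScalars_obj_eq_zero ((hker f).2 hf) J)
  obtain ⟨a, ha⟩ := (restrictScalars.{u} φ).map_surjective (eX.hom ≫ i' ≫ eY.inv)
  obtain ⟨c, hc⟩ := (restrictScalars.{u} φ).map_surjective (eX.hom ≫ g')
  have : Mono a := by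
    apply (restrictScalars.{u} φ).mono_of_mono_map
    rw [ha]
    infer_instance
  refine ⟨ofHom (N Y).mkQ ≫ eY.inv ≫ (restrictScalars.{u} φ).map (Injective.factorThru c a), ?_⟩
  have h1 : i' ≫ eY.inv = eX.inv ≫ (restrictScalars.{u} φ).map a := by
    rw [ha, Iso.inv_hom_id_assoc]
  have h2 : i ≫ ofHom (N Y).mkQ = ofHom (N X).mkQ ≫ i' := rfl
  rw [reassoc_of% h2, reassoc_of% h1, ← Functor.map_comp, Injective.comp_factorThru, hc,
    Iso.inv_hom_id_assoc, hg']

end RestrictScalars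

end ModuleCat

/-! ### Vanishing of Ext groups in short exact sequences -/

namespace CategoryTheory.ShortComplex.ShortExact

open Abelian

universe w v u'

variable {C : Type u'} [Category.{v} C] [Abelian C] [HasExt.{w} C] {T : ShortComplex C}
  (hT : T.ShortExact)

include hT

lemma subsingleton_ext_X₃_left (Y : C) (n : ℕ) (h₁ : Subsingleton (Ext T.X₁ Y n))
    (h₂ : Subsingleton (Ext T.X₂ Y (n + 1))) : Subsingleton (Ext T.X₃ Y (n + 1)) := by
  refine subsingleton_of_forall_eq 0 fun x => ?_
  obtain ⟨y, rfl⟩ := Ext.contravariant_sequence_exact₃ hT Y x (Subsingleton.elim _ _)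
    (add_comm 1 n)
  rw [Subsingleton.elim y 0, Ext.comp_zero]

lemma subsingleton_ext_X₂_left (Y : C) (n : ℕ) (h₁ : Subsingleton (Ext T.X₁ Y n))
    (h₃ : Subsingleton (Ext T.X₃ Y n)) : Subsingleton (Ext T.X₂ Y n) := by
  refine subsingleton_of_forall_eq 0 fun x => ?_
  obtain ⟨y, rfl⟩ := Ext.contravariant_sequence_exact₂ hT Y x (Subsingleton.elim _ _)
  rw [Subsingleton.elim y 0, Ext.comp_zero]

lemma subsingleton_ext_X₁_left (Y : C) (n : ℕ) (h₂ : Subsingleton (Ext T.X₂ Y n))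
    (h₃ : Subsingleton (Ext T.X₃ Y (n + 1))) : Subsingleton (Ext T.X₁ Y n) := by
  refine subsingleton_of_forall_eq 0 fun x => ?_
  obtain ⟨y, rfl⟩ := Ext.contravariant_sequence_exact₁ hT Y x (add_comm 1 n)
    (Subsingleton.elim _ _)
  rw [Subsingleton.elim y 0, Ext.comp_zero]

lemma subsingleton_ext_X₂_right (X : C) (n : ℕ) (h₁ : Subsingleton (Ext X T.X₁ n))
    (h₃ : Subsingleton (Ext X T.X₃ n)) : Subsingleton (Ext X T.X₂ n) := by
  refine subsingleton_of_forall_eq 0 fun x => ?_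
  obtain ⟨y, rfl⟩ := Ext.covariant_sequence_exact₂ X hT x (Subsingleton.elim _ _)
  rw [Subsingleton.elim y 0, Ext.zero_comp]

lemma subsingleton_ext_X₃_right (X : C) (n : ℕ) (h₁ : Subsingleton (Ext X T.X₁ (n + 1)))
    (h₂ : Subsingleton (Ext X T.X₂ n)) : Subsingleton (Ext X T.X₃ n) := by
  refine subsingleton_of_forall_eq 0 fun x => ?_
  obtain ⟨y, rfl⟩ := Ext.covariant_sequence_exact₃ X hT x rfl (Subsingleton.elim _ _)
  rw [Subsingleton.elim y 0, Ext.zero_comp]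

/-- In the lowest degree `Hom(X₁, Y)` need not vanish. Each class is the extension class followed by
some `f : X₁ ⟶ Y`, and it dies once `f` extends over `X₂`. -/
lemma subsingleton_ext_one (Y : C) (h₁ : ∀ f : T.X₁ ⟶ Y, ∃ g : T.X₂ ⟶ Y, T.f ≫ g = f)
    (h₂ : Subsingleton (Ext T.X₂ Y 1)) : Subsingleton (Ext T.X₃ Y 1) := by
  refine subsingleton_of_forall_eq 0 fun x => ?_
  obtain ⟨y, rfl⟩ := Ext.contravariant_sequence_exact₃ hT Y x (Subsingleton.elim _ _)
    (add_zero 1)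
  obtain ⟨f, rfl⟩ := (Ext.mk₀_bijective _ _).2 y
  obtain ⟨g, rfl⟩ := h₁ f
  rw [← Ext.mk₀_comp_mk₀, hT.extClass_comp_assoc]

end CategoryTheory.ShortComplex.ShortExact

lemma CategoryTheory.Abelian.Ext.subsingleton_zero_iff {C : Type*} [Category C] [Abelian C]
    [HasExt C] (X Y : C) : Subsingleton (Abelian.Ext X Y 0) ↔ ∀ f : X ⟶ Y, f = 0 := by
  rw [(Abelian.Ext.addEquiv₀ (X := X) (Y := Y)).toEquiv.subsingleton_congr]
  exact ⟨fun _ f => Subsingleton.elim _ _, fun h => subsingleton_of_forall_eq 0 h⟩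

/-- The short exact sequence of a submodule and its quotient. -/
lemma Submodule.shortExact_mkQ {R : Type u} [Ring R] {M : Type u} [AddCommGroup M] [Module R M]
    (N : Submodule R M) :
    (ShortComplex.mk (ModuleCat.ofHom N.subtype) (ModuleCat.ofHom N.mkQ)
      (by ext x; exact (Submodule.Quotient.mk_eq_zero N).2 x.2)).ShortExact :=
  ModuleCat.shortComplex_shortExact _
    ((LinearMap.exact_subtype_mkQ N : Function.Exact N.subtype N.mkQ))
    N.injective_subtype N.mkQ_surjective

/-! ### Gluing along idempotents -/

/-- The data of a sink-source gluing, for left modules: two surjections `φ : R → R₁` and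
`ψ : R → R₂` whose kernels are `R f₁` and `f₂ R` for idempotents `f₁`, `f₂` with `f₂ R f₁ = 0`, and
such that the corner ring of `1 - f₁ - f₂` consists of scalars. -/
structure IsIdempotentGluing (k : Type u) [Field k] {R R₁ R₂ : Type u} [Ring R] [Ring R₁]
    [Ring R₂] [Algebra k R] (φ : R →+* R₁) (ψ : R →+* R₂) (f₁ f₂ : R) : Prop where
  surjective₁ : Function.Surjective φ
  surjective₂ : Function.Surjective ψ
  idem₁ : f₁ * f₁ = f₁
  idem₂ : f₂ * f₂ = f₂
  ker₁ : ∀ r, φ r = 0 ↔ r * f₁ = r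
  ker₂ : ∀ r, ψ r = 0 ↔ f₂ * r = r
  mul_mul_eq_zero : ∀ r, f₂ * r * f₁ = 0
  corner : ∀ r, ∃ c : k, (1 - f₁ - f₂) * r * (1 - f₁ - f₂) = c • (1 - f₁ - f₂)

/-- The modules killed by a given ring element. -/
def killedBy {R : Type u} [Ring R] (f : R) : ObjectProperty (ModuleCat.{u} R) :=
  fun X => ∀ x : X, f • x = 0

lemma killedBy_of_iso {R : Type u} [Ring R] {f : R} {X Y : ModuleCat.{u} R} (e : X ≅ Y)
    (hX : killedBy f X) : killedBy f Y := fun y => by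
  have : e.hom.hom (e.inv.hom y) = y := by simp
  rw [← this, ← map_smul, hX, map_zero]

namespace IsIdempotentGluing

open Abelian

variable {k : Type u} [Field k] {R R₁ R₂ : Type u} [Ring R] [Ring R₁] [Ring R₂] [Algebra k R]
  {φ : R →+* R₁} {ψ : R →+* R₂} {f₁ f₂ : R} (h : IsIdempotentGluing k φ ψ f₁ f₂)

include h

/-! ### Peirce decomposition with respect to the two idempotents and their complement -/

lemma mul_f₁ (r : R) : f₁ * r * f₁ = f₁ * r :=
  (h.ker₁ _).1 (by rw [map_mul, (h.ker₁ f₁).2 h.idem₁, zero_mul])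

lemma mul_f₂ (r : R) : f₂ * r * f₂ = r * f₂ := by
  rw [mul_assoc]
  exact (h.ker₂ _).1 (by rw [map_mul, (h.ker₂ f₂).2 h.idem₂, mul_zero])

lemma f₂_mul_f₁ : f₂ * f₁ = 0 := by
  have := h.mul_mul_eq_zero 1
  rwa [mul_one] at this

lemma f₁_mul_f₂ : f₁ * f₂ = 0 := by
  rw [← h.mul_f₁ f₂, mul_assoc, h.f₂_mul_f₁, mul_zero]

/-- The Peirce components `s r f₂` and `f₁ r s` vanish, with `s = 1 - f₁ - f₂`. So `s r` acts as `c
s` on modules killed by `f₁`, and `r s` acts as `c s` on modules killed by `f₂`. That the scalar `c`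
is the same for both is what makes the map in `exists_extension` linear over `R`. -/
lemma corner_mul (r : R) : ∃ c : k,
    (1 - f₁ - f₂) * r = algebraMap k R c * (1 - f₁ - f₂) + (1 - f₁ - f₂) * r * f₁ ∧
    r * (1 - f₁ - f₂) = algebraMap k R c * (1 - f₁ - f₂) + f₂ * (r * (1 - f₁ - f₂)) := by
  obtain ⟨c, hc⟩ := h.corner r
  rw [Algebra.smul_def] at hc
  have h12 := h.f₁_mul_f₂
  refine ⟨c, ?_, ?_⟩
  · have : (1 - f₁ - f₂) * r * f₂ = 0 := by
      rw [mul_assoc, ← h.mul_f₂, ← mul_assoc, ← mul_assoc]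
      simp [sub_mul, h12, h.idem₂]
    rw [← hc]
    calc (1 - f₁ - f₂) * r = (1 - f₁ - f₂) * r * (1 - f₁ - f₂) + (1 - f₁ - f₂) * r * f₁
          + (1 - f₁ - f₂) * r * f₂ := by noncomm_ring
      _ = _ := by rw [this, add_zero]
  · have : f₁ * (r * (1 - f₁ - f₂)) = 0 := by
      rw [← mul_assoc, ← h.mul_f₁, mul_assoc]
      simp [mul_sub, h12, h.idem₁]
    rw [← hc]
    calc r * (1 - f₁ - f₂) = (1 - f₁ - f₂) * r * (1 - f₁ - f₂) + f₁ * (r * (1 - f₁ - f₂))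
          + f₂ * (r * (1 - f₁ - f₂)) := by noncomm_ring
      _ = _ := by rw [this, add_zero]

/-- Morphisms from a module killed by `f₁` to a module killed by `f₂` extend along monomorphisms
of modules killed by `f₁`. -/
lemma exists_extension {K P Y : ModuleCat.{u} R} (hK : killedBy f₁ K) (hP : killedBy f₁ P)
    (hY : killedBy f₂ Y) (i : K ⟶ P) (hi : Mono i) (f : K ⟶ Y) :
    ∃ g : P ⟶ Y, i ≫ g = f := by
  rw [ModuleCat.mono_iff_injective] at hi
  let := Module.restrictScalars k R K
  let := Module.restrictScalars k R P
  have : IsScalarTower k R K := IsScalarTower.restrictScalars k R K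
  have : IsScalarTower k R P := IsScalarTower.restrictScalars k R P
  obtain ⟨l, hl⟩ := LinearMap.exists_leftInverse_of_injective (i.hom.restrictScalars k)
    (LinearMap.ker_eq_bot.2 hi)
  have hl' : ∀ x, l (i.hom x) = x := fun x => LinearMap.congr_fun hl x
  set s := 1 - f₁ - f₂ with hs
  -- Only the component at the glued vertex matters for maps from modules killed by `f₁` to modules
  -- killed by `f₂`. There a `k`-linear retraction `l` of `i` is enough, and cutting with `s` on
  -- both sides restores `R`-linearity.
  refine ⟨ModuleCat.ofHom
    { toFun := fun p => s • f.hom (l (s • p))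
      map_add' := fun x y => by simp only [smul_add, map_add]
      map_smul' := fun r x => ?_ }, ?_⟩
  · obtain ⟨c, hc₁, hc₂⟩ := h.corner_mul r
    rw [← hs] at hc₁ hc₂
    rw [RingHom.id_apply, ← mul_smul s r, hc₁, ← mul_smul r s, hc₂]
    simp only [add_smul, mul_smul, hP x, smul_zero, add_zero]
    rw [algebraMap_smul, map_smul, ← algebraMap_smul R c (l _), map_smul, ← mul_smul s, ← mul_smul,
      Algebra.commutes, hY, add_zero]
  · ext x
    change s • f.hom (l (s • i.hom x)) = f.hom x
    have h1 : f₁ • f.hom x = 0 := by rw [← map_smul, hK, map_zero]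
    have h2 : f₂ • f.hom x = 0 := hY _
    rw [← map_smul i.hom, hl', map_smul, hs]
    simp only [sub_smul, one_smul, h1, h2, sub_zero]

/-- A module killed by `f₁` is the quotient of a projective module killed by `f₁`. -/
lemma exists_projective_cover {X : ModuleCat.{u} R} (hX : killedBy f₁ X) :
    ∃ (P : ModuleCat.{u} R) (π : P ⟶ X), Projective P ∧ killedBy f₁ P ∧ Epi π := by
  have := ModuleCat.preservesProjectiveObjects_restrictScalars h.surjective₁ h.idem₁ h.ker₁
  obtain ⟨X', ⟨e⟩⟩ := ModuleCat.exists_restrictScalars_obj_iso h.surjective₁ X (by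
    intro r hr x
    rw [← (h.ker₁ r).1 hr, mul_smul, hX, smul_zero])
  exact ⟨_, (ModuleCat.restrictScalars φ).map (Projective.π X') ≫ e.hom,
    Functor.PreservesProjectiveObjects.projective_obj inferInstance,
    ModuleCat.smul_restrictScalars_obj_eq_zero ((h.ker₁ f₁).2 h.idem₁) _, inferInstance⟩

/-- Dimension shifting along projective covers killed by `f₁`: their kernels are again killed by
`f₁`, and in degree one `exists_extension` extends every map off the kernel. -/
lemma subsingleton_ext_succ {X Y : ModuleCat.{u} R} (hX : killedBy f₁ X) (hY : killedBy f₂ Y)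
    (n : ℕ) : Subsingleton (Ext X Y (n + 1)) := by
  induction n generalizing X with
  | zero =>
    obtain ⟨P, π, hP, hP', hπ⟩ := h.exists_projective_cover hX
    rw [ModuleCat.epi_iff_surjective] at hπ
    have hS := LinearMap.shortExact_shortComplexKer (f := π.hom) hπ
    have hK : killedBy f₁ π.hom.shortComplexKer.X₁ := fun x => Subtype.ext (hP' _)
    exact hS.subsingleton_ext_one Y
      (fun f => h.exists_extension hK hP' hY _ hS.mono_f f)
      (Ext.subsingleton_of_projective P Y 0)
  | succ n ih =>
    obtain ⟨P, π, hP, hP', hπ⟩ := h.exists_projective_cover hX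
    rw [ModuleCat.epi_iff_surjective] at hπ
    have hS := LinearMap.shortExact_shortComplexKer (f := π.hom) hπ
    have hK : killedBy f₁ π.hom.shortComplexKer.X₁ := fun x => Subtype.ext (hP' _)
    exact hS.subsingleton_ext_X₃_left Y (n + 1) (ih hK)
      (Ext.subsingleton_of_projective P Y (n + 1))

/-- A finitely generated module `Y` generated by `f₁ Y` is the quotient of a finitely generated
projective module that is killed by `f₂` and has no nonzero morphism to a module killed by `f₁`. -/
lemma exists_projective_cover_of_span_eq_top {Y : ModuleCat.{u} R} [Module.Finite R Y]
    (hY : Submodule.span R (Set.range fun y : Y => f₁ • y) = ⊤) :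
    ∃ (P : ModuleCat.{u} R) (π : P ⟶ Y), Projective P ∧ Module.Finite R P ∧ killedBy f₂ P ∧
      Epi π ∧ ∀ T, killedBy f₁ T → ∀ g : P ⟶ T, g = 0 := by
  obtain ⟨n, p, hp⟩ := Module.Finite.exists_fin' R Y
  -- Coordinatewise right multiplication by `f₁` is idempotent with range `(R f₁)^n`. This range is
  -- the required projective: `f₂ R f₁ = 0` makes `f₂` kill it.
  let ρ : (Fin n → R) →ₗ[R] (Fin n → R) := (LinearMap.toSpanSingleton R R f₁).compLeft (Fin n)
  have hρ : ∀ x i, ρ x i = x i * f₁ := fun x i => rfl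
  have hρρ : ∀ x, ρ (ρ x) = ρ x := fun x => by
    ext i
    rw [hρ, hρ, mul_assoc, h.idem₁]
  have hproj : Module.Projective R ρ.range := by
    refine Module.Projective.of_split ρ.range.subtype ρ.rangeRestrict ?_
    ext1 ⟨_, x, rfl⟩
    exact Subtype.ext (hρρ x)
  let Pm : ModuleCat.{u} R := ModuleCat.of R ρ.range
  have hPm : Module.Projective R Pm := hproj
  refine ⟨Pm, ModuleCat.ofHom (p ∘ₗ ρ.range.subtype),
    ModuleCat.projective_of_categoryTheory_projective Pm, Module.Finite.range ρ, ?_, ?_, ?_⟩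
  · rintro ⟨_, x, rfl⟩
    refine Subtype.ext (funext fun i => ?_)
    change f₂ * (x i * f₁) = 0
    rw [← mul_assoc, h.mul_mul_eq_zero]
  · rw [ModuleCat.epi_iff_range_eq_top, eq_top_iff, ← hY, Submodule.span_le]
    rintro _ ⟨y, rfl⟩
    obtain ⟨x, rfl⟩ := hp y
    refine ⟨⟨f₁ • x, f₁ • x, funext fun i => ?_⟩, map_smul p f₁ x⟩
    rw [hρ]
    exact h.mul_f₁ (x i)
  · intro T hT g
    have hz : g.hom ∘ₗ ρ.rangeRestrict = 0 := by
      refine LinearMap.pi_ext' fun i => LinearMap.ext_ring ?_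
      change g.hom (ρ.rangeRestrict (Pi.single i 1)) = 0
      -- The generators of the projective are fixed by `f₁`, so their images in a module killed by
      -- `f₁` vanish.
      have : ρ.rangeRestrict (Pi.single i 1) = f₁ • ρ.rangeRestrict (Pi.single i (1 : R)) := by
        refine Subtype.ext (funext fun j => ?_)
        change (Pi.single i 1 : Fin n → R) j * f₁ = f₁ * ((Pi.single i 1 : Fin n → R) j * f₁)
        by_cases hj : j = i
        · subst hj; simp [h.idem₁]
        · simp [hj]
      rw [this]
      exact (map_smul g.hom f₁ _).trans (hT _)
    ext ⟨_, x, rfl⟩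
    exact LinearMap.congr_fun hz x

/-- Vanishing of `Ext` from a module killed by `f₂` to a module killed by `f₁` that has no nonzero
submodule killed by `f₂`. -/
lemma subsingleton_ext_of_forall_eq_zero [IsNoetherianRing R] {X : ModuleCat.{u} R}
    (hX : ∀ x : X, (∀ r : R, f₂ • r • x = 0) → x = 0) (i : ℕ) (Y : ModuleCat.{u} R)
    [Module.Finite R Y] (hY : killedBy f₂ Y)
    (hE : ∀ j l, j + l = i →
      (∀ T : ModuleCat.{u} R, Module.Finite R T → killedBy f₁ T → killedBy f₂ T →
        Subsingleton (Ext Y T j)) ∨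
      (∀ T : ModuleCat.{u} R, Module.Finite R T → killedBy f₁ T → killedBy f₂ T →
        Subsingleton (Ext T X l))) :
    Subsingleton (Ext Y X i) := by
  induction i generalizing Y with
  | zero =>
    rw [Ext.subsingleton_zero_iff]
    intro f
    ext y
    refine hX _ fun r => ?_
    rw [← map_smul, ← map_smul, hY, map_zero]
  | succ i ih =>
    -- `Y / N` is the largest quotient of `Y` killed by `f₁`; being also killed by `f₂`, it is one
    -- of the test modules `T`. The submodule `N` has the special covers just constructed.
    let N : Submodule R Y := Submodule.span R (Set.range fun y : Y => f₁ • y)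
    have hN := N.shortExact_mkQ
    have hQ₁ : killedBy f₁ (ModuleCat.of R (Y ⧸ N)) := fun x => by
      obtain ⟨y, rfl⟩ := Submodule.Quotient.mk_surjective _ x
      exact (Submodule.Quotient.mk_eq_zero N).2 (Submodule.subset_span ⟨y, rfl⟩)
    have hQ₂ : killedBy f₂ (ModuleCat.of R (Y ⧸ N)) := fun x => by
      obtain ⟨y, rfl⟩ := Submodule.Quotient.mk_surjective _ x
      rw [← Submodule.Quotient.mk_smul, hY, Submodule.Quotient.mk_zero]
    have hQf : Module.Finite R (ModuleCat.of R (Y ⧸ N)) := Module.Finite.quotient R N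
    have hQ : Subsingleton (Ext (ModuleCat.of R (Y ⧸ N)) X (i + 1)) := by
      -- In the splitting `0 + (i + 1)`, either `Hom(Y, T) = 0` for all `T`, which forces `Y / N =
      -- 0`, or `Ext^(i+1)(Y / N, X)` vanishes by assumption.
      rcases hE 0 (i + 1) (zero_add _) with h0 | h0
      · have h1 := (Ext.subsingleton_zero_iff _ _).1 (h0 _ hQf hQ₁ hQ₂) (ModuleCat.ofHom N.mkQ)
        have h2 : IsZero (ModuleCat.of R (Y ⧸ N)) := by
          rw [ModuleCat.isZero_iff_subsingleton]
          refine subsingleton_of_forall_eq 0 fun x => ?_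
          obtain ⟨y, rfl⟩ := N.mkQ_surjective x
          exact LinearMap.congr_fun (congrArg ModuleCat.Hom.hom h1) y
        have : Projective (ModuleCat.of R (Y ⧸ N)) := h2.projective
        exact Ext.subsingleton_of_projective _ _ _
      · exact h0 _ hQf hQ₁ hQ₂
    refine hN.subsingleton_ext_X₂_left X (i + 1) ?_ hQ
    have hNf : Module.Finite R N := inferInstance
    have hNf' : Module.Finite R (ModuleCat.of R N) := hNf
    have hN₂ : killedBy f₂ (ModuleCat.of R N) := fun x => Subtype.ext (hY _)
    have hNtop : Submodule.span R (Set.range fun y : ModuleCat.of R N => f₁ • y) = ⊤ := by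
      refine Submodule.map_injective_of_injective N.injective_subtype ?_
      rw [Submodule.map_span, Submodule.map_top, Submodule.range_subtype]
      refine le_antisymm (Submodule.span_le.2 ?_) (Submodule.span_le.2 ?_)
      · rintro _ ⟨y, -, rfl⟩
        exact y.2
      · rintro _ ⟨y, rfl⟩
        refine Submodule.subset_span ⟨_, ⟨⟨f₁ • y, Submodule.subset_span ⟨y, rfl⟩⟩, rfl⟩, ?_⟩
        change f₁ • f₁ • y = f₁ • y
        rw [← mul_smul, h.idem₁]
    obtain ⟨P, π, hP, hPf, hP₂, hπ, hP₀⟩ := h.exists_projective_cover_of_span_eq_top hNtop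
    rw [ModuleCat.epi_iff_surjective] at hπ
    have hS := LinearMap.shortExact_shortComplexKer (f := π.hom) hπ
    have hK : killedBy f₂ π.hom.shortComplexKer.X₁ := fun x => Subtype.ext (hP₂ _)
    have hKf : Module.Finite R π.hom.shortComplexKer.X₁ :=
      inferInstanceAs (Module.Finite R (LinearMap.ker π.hom))
    refine hS.subsingleton_ext_X₃_left X i (ih _ hK fun j l hjl => ?_)
      (Ext.subsingleton_of_projective P X i)
    -- The splitting `i = j + l` for the kernel `K` comes from `i + 1 = (j + 1) + l` for `Y`.
    -- Vanishing passes from `Ext^(j+1)(Y, T)` to `Ext^(j+1)(N, T)` and on to `Ext^j(K, T)`. For `j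
    -- = 0` the last passage needs `Hom(P, T) = 0`, the reason for the special choice of `P`.
    refine (hE (j + 1) l (by omega)).imp_left fun h0 T hTf hT₁ hT₂ => ?_
    refine hS.subsingleton_ext_X₁_left T j ?_ ?_
    · cases j with
      | zero => exact (Ext.subsingleton_zero_iff _ _).2 (hP₀ T hT₁)
      | succ j => exact Ext.subsingleton_of_projective P T j
    · exact hN.subsingleton_ext_X₁_left T (j + 1) (h0 T hTf hT₁ hT₂)
        (h.subsingleton_ext_succ hQ₁ hT₂ (j + 1))

/-- Vanishing of `Ext` from a module killed by `f₂` to a module killed by `f₁`. -/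
lemma subsingleton_ext [IsNoetherianRing R] {X Y : ModuleCat.{u} R}
    [Module.Finite R X] [Module.Finite R Y] (hX : killedBy f₁ X) (hY : killedBy f₂ Y) (i : ℕ)
    (hE : ∀ j l, j + l = i →
      (∀ T : ModuleCat.{u} R, Module.Finite R T → killedBy f₁ T → killedBy f₂ T →
        Subsingleton (Ext Y T j)) ∨
      (∀ T : ModuleCat.{u} R, Module.Finite R T → killedBy f₁ T → killedBy f₂ T →
        Subsingleton (Ext T X l)))
    (hE' : ∀ T : ModuleCat.{u} R, Module.Finite R T → killedBy f₁ T → killedBy f₂ T →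
        Subsingleton (Ext Y T i)) :
    Subsingleton (Ext Y X i) := by
  -- The largest submodule of `X` killed by `f₂`. It is killed by both idempotents, so `hE'` handles
  -- it, and `X / N` has no nonzero submodule killed by `f₂`.
  let N : Submodule R X :=
    { carrier := {x | ∀ r : R, f₂ • r • x = 0}
      add_mem' := fun {x y} hx hy r => by rw [smul_add, smul_add, hx, hy, add_zero]
      zero_mem' := fun r => by simp
      smul_mem' := fun r x hx r' => by rw [← mul_smul r' r]; exact hx _ }
  have hN := N.shortExact_mkQ
  have hN₁ : killedBy f₁ (ModuleCat.of R N) := fun x => Subtype.ext (hX _)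
  have hN₂ : killedBy f₂ (ModuleCat.of R N) := fun x => Subtype.ext (by
    have := x.2 1
    rwa [one_smul] at this)
  have hNf : Module.Finite R (ModuleCat.of R N) := inferInstanceAs (Module.Finite R N)
  refine hN.subsingleton_ext_X₂_right Y i (hE' _ hNf hN₁ hN₂)
    (h.subsingleton_ext_of_forall_eq_zero ?_ i Y hY fun j l hjl => (hE j l hjl).imp_right ?_)
  · intro x hx
    obtain ⟨x, rfl⟩ := Submodule.Quotient.mk_surjective _ x
    refine (Submodule.Quotient.mk_eq_zero N).2 fun r => ?_
    have h1 : f₂ • r • x ∈ N := (Submodule.Quotient.mk_eq_zero N).1 (hx r)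
    have h2 := h1 1
    rwa [one_smul, ← mul_smul f₂ f₂, h.idem₂] at h2
  · intro h0 T hTf hT₁ hT₂
    -- The hypothesis on `Ext^l(T, X)` descends to `X / N`, because the obstruction group
    -- `Ext^(l+1)(T, N)` is zero.
    exact hN.subsingleton_ext_X₃_right T l (h.subsingleton_ext_succ hT₁ hN₂ l)
      (h0 T hTf hT₁ hT₂)

/-- Every module is the direct sum of a module killed by `f₁` and a module killed by `f₂`. -/
lemma exists_iso_biprod (X : ModuleCat.{u} R) :
    ∃ P N : ModuleCat.{u} R, killedBy f₁ P ∧ killedBy f₂ N ∧ Nonempty (X ≅ P ⊞ N) := by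
  let := Module.restrictScalars k R X
  have : IsScalarTower k R X := IsScalarTower.restrictScalars k R X
  set s := 1 - f₁ - f₂ with hs
  have hsf₁ : f₁ * s = 0 := by simp [hs, mul_sub, h.idem₁, h.f₁_mul_f₂]
  have hsf₂ : f₂ * s = 0 := by simp [hs, mul_sub, h.idem₂, h.f₂_mul_f₁]
  have hss : s * s = s := by
    conv_lhs => rw [hs, sub_mul, sub_mul, hsf₁, hsf₂, one_mul, sub_zero, sub_zero]
  let N : Submodule R X := Submodule.span R (Set.range fun x : X => f₁ • x)
  have hN : ∀ x ∈ N, f₂ • x = 0 := by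
    intro x hx
    induction hx using Submodule.span_induction with
    | mem x hx =>
      obtain ⟨y, rfl⟩ := hx
      change f₂ • f₁ • y = 0
      rw [← mul_smul, h.f₂_mul_f₁, zero_smul]
    | zero => exact smul_zero _
    | add x y _ _ hx hy => rw [smul_add, hx, hy, add_zero]
    | smul r x hx' hx =>
      -- The induction hypothesis `f₂ • x = 0` says nothing about `f₂ • r • x`; the statement must
      -- be proved for all `r` at once, using `f₂ R f₁ = 0`.
      have hx'' : ∀ y ∈ N, ∀ r : R, f₂ • r • y = 0 := by
        intro y hy
        induction hy using Submodule.span_induction with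
        | mem y hy =>
          obtain ⟨z, rfl⟩ := hy
          intro r
          change f₂ • r • f₁ • z = 0
          rw [← mul_smul, ← mul_smul, h.mul_mul_eq_zero, zero_smul]
        | zero => intro r; simp
        | add y z _ _ hy hz => intro r; rw [smul_add, smul_add, hy, hz, add_zero]
        | smul r' y _ hy => intro r; rw [← mul_smul r r']; exact hy _
      exact hx'' x hx' r
  -- `W = s X`; inside it `K` is the part generated by `f₁ X`, and `C` is a `k`-linear complement of
  -- `K` in `W`.
  let W : Submodule k X :=
    { carrier := {x | s • x = x}
      add_mem' := fun {x y} hx hy => by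
        rw [Set.mem_ofPred_eq] at *
        rw [smul_add, hx, hy]
      zero_mem' := smul_zero _
      smul_mem' := fun c x hx => by
        rw [Set.mem_ofPred_eq] at *
        rw [smul_comm, hx] }
  let K : Submodule k X := N.restrictScalars k ⊓ W
  obtain ⟨C', hC'⟩ := exists_isCompl K
  let C := C' ⊓ W
  have hCW : ∀ c ∈ C, s • c = c := fun c hc => hc.2
  have hKC : K ⊔ C = W := by
    rw [← sup_inf_assoc_of_le C' (inf_le_right : K ≤ W), hC'.sup_eq_top, top_inf_eq]
  have hf₂s : ∀ c ∈ C, f₂ • c = 0 := fun c hc => by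
    rw [← hCW c hc, ← mul_smul, hsf₂, zero_smul]
  -- This is `f₂ X ⊕ C`. It is stable under `R` since `r` acts on `C ⊆ s X` as a scalar up to an
  -- element of `f₂ X`.
  let P : Submodule R X :=
    { carrier := {x | x - f₂ • x ∈ C}
      add_mem' := fun {x y} hx hy => by
        rw [Set.mem_ofPred_eq] at *
        rw [smul_add, add_sub_add_comm]
        exact C.add_mem hx hy
      zero_mem' := by simp
      smul_mem' := fun r x hx => by
        rw [Set.mem_ofPred_eq] at *
        obtain ⟨c, -, hc⟩ := h.corner_mul r
        rw [← hs] at hc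
        have h1 : r • x - f₂ • r • x = r • (x - f₂ • x) - f₂ • r • (x - f₂ • x) := by
          have := h.mul_f₂ r
          simp only [smul_sub, ← mul_smul]
          rw [← mul_assoc, this]
          abel
        have h2 : r • (x - f₂ • x) = c • (x - f₂ • x) + f₂ • r • (x - f₂ • x) := by
          conv_lhs => rw [← hCW _ hx, ← mul_smul, hc, add_smul, mul_smul, mul_smul, mul_smul,
            hCW _ hx, algebraMap_smul]
        rw [h1, h2, smul_add, ← mul_smul f₂ f₂, h.idem₂, smul_comm f₂ c, hf₂s _ hx, smul_zero,
          zero_add, add_sub_cancel_right]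
        exact C.smul_mem c hx }
  have hCP : ∀ c ∈ C, c ∈ P := fun c hc => by
    change c - f₂ • c ∈ C
    rwa [hf₂s c hc, sub_zero]
  have hPN : IsCompl P N := by
    rw [isCompl_iff, disjoint_iff, codisjoint_iff, eq_bot_iff, eq_top_iff]
    constructor
    · rintro x ⟨hx, hx'⟩
      have hxC : x ∈ C := by
        have : x - f₂ • x ∈ C := hx
        rwa [hN x hx', sub_zero] at this
      have : x ∈ K ⊓ C' := ⟨⟨hx', hCW x hxC⟩, hxC.1⟩
      rw [hC'.inf_eq_bot] at this
      exact this
    · rintro x -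
      have hx : x = f₂ • x + s • x + f₁ • x := by
        rw [hs, sub_smul, sub_smul, one_smul]; abel
      rw [hx]
      refine Submodule.add_mem _ (Submodule.add_mem _ ?_ ?_) ?_
      · refine Submodule.mem_sup_left ?_
        change f₂ • x - f₂ • f₂ • x ∈ C
        rw [← mul_smul, h.idem₂, sub_self]
        exact C.zero_mem
      · have hW : s • x ∈ W := by
          change s • s • x = s • x
          rw [← mul_smul, hss]
        rw [← hKC] at hW
        obtain ⟨y, hy, z, hz, hyz⟩ := Submodule.mem_sup.1 hW
        rw [← hyz]
        exact Submodule.add_mem _ (Submodule.mem_sup_right hy.1)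
          (Submodule.mem_sup_left (hCP z hz))
      · exact Submodule.mem_sup_right (Submodule.subset_span ⟨x, rfl⟩)
  refine ⟨ModuleCat.of R P, ModuleCat.of R N, ?_, fun x => Subtype.ext (hN _ x.2),
    ⟨(Submodule.prodEquivOfIsCompl P N hPN).symm.toModuleIso ≪≫
      (ModuleCat.biprodIsoProd (ModuleCat.of R P) (ModuleCat.of R N)).symm⟩⟩
  rintro ⟨x, hx⟩
  refine Subtype.ext ?_
  have hx' : x - f₂ • x ∈ C := hx
  have h1 : f₁ • (x - f₂ • x) = 0 := by
    rw [← hCW _ hx', ← mul_smul, hsf₁, zero_smul]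
  rw [smul_sub, ← mul_smul, h.f₁_mul_f₂, zero_smul, sub_zero] at h1
  exact h1

end IsIdempotentGluing

/-! ### Additive closures -/

section AddClosure

open Abelian

/-- Every class is recovered from its transport to `Ext X' Y' n` by composing back with the
retractions, and that transport is zero. -/
lemma CategoryTheory.Retract.subsingleton_ext {C : Type*} [Category C] [Abelian C] [HasExt C]
    {X X' Y Y' : C} (r : Retract X X') (s : Retract Y Y') (n : ℕ)
    (h : Subsingleton (Ext X' Y' n)) : Subsingleton (Ext X Y n) := by
  refine subsingleton_of_forall_eq 0 fun x => ?_
  have h1 : (Ext.mk₀ r.r).comp (x.comp (Ext.mk₀ s.i) (add_zero n)) (zero_add n) = 0 :=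
    Subsingleton.elim _ _
  have h2 : x = (Ext.mk₀ r.i).comp (((Ext.mk₀ r.r).comp (x.comp (Ext.mk₀ s.i) (add_zero n))
      (zero_add n)).comp (Ext.mk₀ s.r) (add_zero n)) (zero_add n) := by
    simp only [Ext.comp_assoc_of_third_deg_zero, Ext.mk₀_comp_mk₀, s.retract, Ext.comp_mk₀_id,
      Ext.mk₀_comp_mk₀_assoc, r.retract, Ext.mk₀_id_comp]
  rw [h2, h1, Ext.zero_comp, Ext.comp_zero]

variable {A : Type u} [Ring A]

lemma fgMod_of_epi {X Y : RightMod A} (f : X ⟶ Y) [Epi f] (hX : fgMod A X) : fgMod A Y := by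
  have : Module.Finite Aᵐᵒᵖ X := hX
  exact Module.Finite.of_surjective f.hom ((ModuleCat.epi_iff_surjective f).1 inferInstance)

lemma fgMod_of_retract {X Y : RightMod A} (r : Retract X Y) (hY : fgMod A Y) : fgMod A X :=
  have : Epi r.r := SplitEpi.epi ⟨r.i, r.retract⟩
  fgMod_of_epi r.r hY

variable {P : ObjectProperty (RightMod A)}

lemma le_addClosure : P ≤ addClosure P := fun X hX =>
  ⟨1, fun _ => X, fun _ => hX, ⟨{ i := biproduct.ι (fun _ : Fin 1 => X) 0
                                  r := biproduct.π (fun _ : Fin 1 => X) 0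
                                  retract := by simp }⟩⟩

lemma addClosure_of_retract {X Y : RightMod A} (r : Retract X Y) (hY : addClosure P Y) :
    addClosure P X := by
  obtain ⟨n, Z, hZ, ⟨s⟩⟩ := hY
  exact ⟨n, Z, hZ, ⟨r.trans s⟩⟩

lemma addClosure_biprod {X Y : RightMod A} (hX : P X) (hY : P Y) : addClosure P (X ⊞ Y) := by
  have key : ∀ Z : Fin 2 → RightMod A, (∀ i, P (Z i)) → addClosure P (Z 0 ⊞ Z 1) := fun Z hZ => by
    refine ⟨2, Z, hZ, ⟨{
      i := biprod.desc (biproduct.ι Z 0) (biproduct.ι Z 1)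
      r := biprod.lift (biproduct.π Z 0) (biproduct.π Z 1)
      retract := ?_ }⟩⟩
    have h01 : biproduct.ι Z 0 ≫ biproduct.π Z 1 = 0 := biproduct.ι_π_ne Z (by decide)
    have h10 : biproduct.ι Z 1 ≫ biproduct.π Z 0 = 0 := biproduct.ι_π_ne Z (by decide)
    apply biprod.hom_ext' <;> apply biprod.hom_ext <;> simp [h01, h10]
  refine key ![X, Y] fun i => ?_
  fin_cases i
  exacts [hX, hY]

lemma addClosure_le_fgMod (hP : P ≤ fgMod A) : addClosure P ≤ fgMod A := by
  rintro X ⟨n, Y, hY, ⟨r⟩⟩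
  refine fgMod_of_retract r ?_
  have : ∀ i, Module.Finite Aᵐᵒᵖ (Y i) := fun i => hP _ (hY i)
  exact fgMod_of_epi (ModuleCat.biproductIsoPi Y).inv
    (inferInstanceAs (Module.Finite Aᵐᵒᵖ (∀ i, Y i)))

lemma addClosure_subsingleton_ext {n : ℕ} (hP : ∀ X Y, P X → P Y → Subsingleton (Ext X Y n))
    {X Y : RightMod A} (hX : addClosure P X) (hY : addClosure P Y) :
    Subsingleton (Ext X Y n) := by
  obtain ⟨p, Z, hZ, ⟨r⟩⟩ := hX
  obtain ⟨q, W, hW, ⟨s⟩⟩ := hY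
  refine r.subsingleton_ext s n ?_
  rw [(Ext.biproductAddEquiv (biproduct.isBilimit Z) (⨁ W) n).toEquiv.subsingleton_congr]
  have : ∀ i, Subsingleton (Ext (Z i) (⨁ W) n) := fun i => by
    rw [(Ext.addEquivBiproduct (Z i) (biproduct.isBilimit W) n).toEquiv.subsingleton_congr]
    have : ∀ j, Subsingleton (Ext (Z i) (W j) n) := fun j => hP _ _ (hZ i) (hW j)
    infer_instance
  infer_instance

lemma addClosure_exists_lift {X C : RightMod A} (f : X ⟶ C)
    (hf : ∀ (X' : RightMod A) (g : X' ⟶ C), P X' → ∃ h : X' ⟶ X, h ≫ f = g)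
    (X' : RightMod A) (g : X' ⟶ C) (hX' : addClosure P X') : ∃ h : X' ⟶ X, h ≫ f = g := by
  obtain ⟨n, Y, hY, ⟨r⟩⟩ := hX'
  choose h hh using fun i => hf (Y i) (biproduct.ι Y i ≫ r.r ≫ g) (hY i)
  refine ⟨r.i ≫ biproduct.desc h, ?_⟩
  have : biproduct.desc h ≫ f = r.r ≫ g := by
    apply biproduct.hom_ext'
    intro i
    rw [biproduct.ι_desc_assoc, hh]
  rw [Category.assoc, this, r.retract_assoc]

lemma addClosure_exists_desc {X C : RightMod A} (f : C ⟶ X)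
    (hf : ∀ (X' : RightMod A) (g : C ⟶ X'), P X' → ∃ h : X ⟶ X', f ≫ h = g)
    (X' : RightMod A) (g : C ⟶ X') (hX' : addClosure P X') : ∃ h : X ⟶ X', f ≫ h = g := by
  obtain ⟨n, Y, hY, ⟨r⟩⟩ := hX'
  choose h hh using fun i => hf (Y i) (g ≫ r.i ≫ biproduct.π Y i) (hY i)
  refine ⟨biproduct.lift h ≫ r.r, ?_⟩
  have : f ≫ biproduct.lift h = g ≫ r.i := by
    apply biproduct.hom_ext
    intro i
    rw [Category.assoc, biproduct.lift_π, hh, Category.assoc]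
  rw [reassoc_of% this, r.retract, Category.comp_id]

end AddClosure

/-! ### Approximations in the image of a full functor -/

section Approximation

variable {C D : Type*} [Category C] [Category D] (F : C ⥤ D) [F.Full] {M : ObjectProperty C}

/-- Fullness brings the second factor `q` back to `C`, where the approximation property applies; the
source `W` itself need not come from `C`. -/
lemma exists_lift_map_of_factors {X Z : C} (f : X ⟶ Z)
    (hf : ∀ (X' : C) (g : X' ⟶ Z), M X' → ∃ h : X' ⟶ X, h ≫ f = g) {W T : D} (hT : M.map F T)
    (p : W ⟶ T) (q : T ⟶ F.obj Z) : ∃ h : W ⟶ F.obj X, h ≫ F.map f = p ≫ q := by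
  obtain ⟨T', hT', ⟨e⟩⟩ := hT
  obtain ⟨q', hq'⟩ := F.map_surjective (e.hom ≫ q)
  obtain ⟨h, rfl⟩ := hf T' q' hT'
  refine ⟨p ≫ e.inv ≫ F.map h, ?_⟩
  rw [Category.assoc, Category.assoc, ← F.map_comp, hq', Iso.inv_hom_id_assoc]

lemma exists_desc_map_of_factors {X Z : C} (f : Z ⟶ X)
    (hf : ∀ (X' : C) (g : Z ⟶ X'), M X' → ∃ h : X ⟶ X', f ≫ h = g) {W T : D} (hT : M.map F T)
    (p : F.obj Z ⟶ T) (q : T ⟶ W) : ∃ h : F.obj X ⟶ W, F.map f ≫ h = p ≫ q := by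
  obtain ⟨T', hT', ⟨e⟩⟩ := hT
  obtain ⟨p', hp'⟩ := F.map_surjective (p ≫ e.inv)
  obtain ⟨h, rfl⟩ := hf T' p' hT'
  refine ⟨F.map h ≫ e.hom ≫ q, ?_⟩
  rw [← Category.assoc, ← F.map_comp, hp', Category.assoc, Iso.inv_hom_id_assoc]

end Approximation

/-! ### Cluster tilting subcategories of gluings -/

namespace IsIdempotentGluing

open Abelian

variable {k : Type u} [Field k] {L A B : Type u} [Ring L] [Ring A] [Ring B] [Algebra k Lᵐᵒᵖ]
  {φ : L →+* A} {ψ : L →+* B} {f₁ f₂ : Lᵐᵒᵖ}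
  (h : IsIdempotentGluing k (RingHom.op φ) (RingHom.op ψ) f₁ f₂)

include h

/-! ### Comparison of the two module categories with their images under inflation -/

lemma killedBy₁_obj (X : RightMod A) : killedBy f₁ ((inflation φ).obj X) :=
  ModuleCat.smul_restrictScalars_obj_eq_zero ((h.ker₁ f₁).2 h.idem₁) X

lemma killedBy₂_obj (X : RightMod B) : killedBy f₂ ((inflation ψ).obj X) :=
  ModuleCat.smul_restrictScalars_obj_eq_zero ((h.ker₂ f₂).2 h.idem₂) X

lemma exists_iso₁ {X : RightMod L} (hX : killedBy f₁ X) :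
    ∃ Y : RightMod A, Nonempty ((inflation φ).obj Y ≅ X) :=
  ModuleCat.exists_restrictScalars_obj_iso h.surjective₁ X (by
    intro r hr x
    rw [← (h.ker₁ r).1 hr, mul_smul, hX, smul_zero])

lemma exists_iso₂ {X : RightMod L} (hX : killedBy f₂ X) :
    ∃ Y : RightMod B, Nonempty ((inflation ψ).obj Y ≅ X) :=
  ModuleCat.exists_restrictScalars_obj_iso h.surjective₂ X (by
    intro r hr x
    rw [← (h.ker₂ r).1 hr, mul_smul]
    exact hX _)

lemma fgMod₁_iff (X : RightMod A) : fgMod L ((inflation φ).obj X) ↔ fgMod A X :=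
  ModuleCat.finite_restrictScalars_obj_iff h.surjective₁ X

lemma fgMod₂_iff (X : RightMod B) : fgMod L ((inflation ψ).obj X) ↔ fgMod B X :=
  ModuleCat.finite_restrictScalars_obj_iff h.surjective₂ X

/-- Inflation from `A` is exact, fully faithful and preserves projectives, so it induces bijections
on `Ext`. On the `B` side, preservation of injectives plays this role. -/
lemma subsingleton_ext₁_iff (X Y : RightMod A) (n : ℕ) :
    Subsingleton (Ext ((inflation φ).obj X) ((inflation φ).obj Y) n) ↔
      Subsingleton (Ext X Y n) := by
  have := ModuleCat.full_restrictScalars h.surjective₁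
  have := ModuleCat.preservesProjectiveObjects_restrictScalars h.surjective₁ h.idem₁ h.ker₁
  exact (Equiv.ofBijective _
    ((inflation φ).mapExt_bijective_of_preservesProjectiveObjects X Y n)).subsingleton_congr.symm

lemma subsingleton_ext₂_iff (X Y : RightMod B) (n : ℕ) :
    Subsingleton (Ext ((inflation ψ).obj X) ((inflation ψ).obj Y) n) ↔
      Subsingleton (Ext X Y n) := by
  have := ModuleCat.full_restrictScalars h.surjective₂
  have := ModuleCat.preservesInjectiveObjects_restrictScalars h.surjective₂ h.idem₂ h.ker₂
  exact (Equiv.ofBijective _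
    ((inflation ψ).mapExt_bijective_of_preservesInjectiveObjects X Y n)).subsingleton_congr.symm

/-- Every finitely generated module is a direct sum of inflations. -/
lemma exists_iso_biprod_inflation {C : RightMod L} (hC : fgMod L C) :
    ∃ (X : RightMod A) (Y : RightMod B), fgMod A X ∧ fgMod B Y ∧
      Nonempty (C ≅ (inflation φ).obj X ⊞ (inflation ψ).obj Y) := by
  obtain ⟨P, N, hP, hN, ⟨e⟩⟩ := h.exists_iso_biprod C
  obtain ⟨X, ⟨eX⟩⟩ := h.exists_iso₁ hP
  obtain ⟨Y, ⟨eY⟩⟩ := h.exists_iso₂ hN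
  let e' : C ≅ (inflation φ).obj X ⊞ (inflation ψ).obj Y := e ≪≫ (biprod.mapIso eX eY).symm
  exact ⟨X, Y, (h.fgMod₁_iff X).1 (fgMod_of_epi (e'.hom ≫ biprod.fst) hC),
    (h.fgMod₂_iff Y).1 (fgMod_of_epi (e'.hom ≫ biprod.snd) hC), ⟨e'⟩⟩

variable {d : ℕ} {MA : ObjectProperty (RightMod A)} {MB : ObjectProperty (RightMod B)}

/-- Since `f₂` kills `T`, no positive `Ext` from an `A`-module into `T` survives, so `T` satisfies
the `Ext`-vanishing criterion for `MA`. It behaves as an injective `A`-module. -/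
lemma map₁_of_killedBy (hMA : IsClusterTilting d MA) {T : RightMod L} (hT : fgMod L T)
    (hT₁ : killedBy f₁ T) (hT₂ : killedBy f₂ T) : MA.map (inflation φ) T := by
  obtain ⟨T', ⟨e⟩⟩ := h.exists_iso₁ hT₁
  refine ⟨T', (hMA.eq_right T').2 ⟨(h.fgMod₁_iff T').1 (fgMod_of_epi e.inv hT), ?_⟩, ⟨e⟩⟩
  intro Y _ i hi _
  obtain ⟨i, rfl⟩ := Nat.exists_eq_succ_of_ne_zero hi.ne'
  exact (h.subsingleton_ext₁_iff Y T' _).1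
    (h.subsingleton_ext_succ (h.killedBy₁_obj Y) (killedBy_of_iso e.symm hT₂) i)

/-- Dually, no positive `Ext` from `T` to a `B`-module survives: `T` behaves as a projective
`B`-module, so the other `Ext`-vanishing criterion is the one to use. -/
lemma map₂_of_killedBy (hMB : IsClusterTilting d MB) {T : RightMod L} (hT : fgMod L T)
    (hT₁ : killedBy f₁ T) (hT₂ : killedBy f₂ T) : MB.map (inflation ψ) T := by
  obtain ⟨T', ⟨e⟩⟩ := h.exists_iso₂ hT₂
  refine ⟨T', (hMB.eq_left T').2 ⟨(h.fgMod₂_iff T').1 (fgMod_of_epi e.inv hT), ?_⟩, ⟨e⟩⟩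
  intro Y _ i hi _
  obtain ⟨i, rfl⟩ := Nat.exists_eq_succ_of_ne_zero hi.ne'
  exact (h.subsingleton_ext₂_iff T' Y _).1
    (h.subsingleton_ext_succ (killedBy_of_iso e.symm hT₁) (h.killedBy₂_obj Y) i)

lemma map₁_sup_map₂_le_fgMod (hMA : IsClusterTilting d MA) (hMB : IsClusterTilting d MB) :
    MA.map (inflation φ) ⊔ MB.map (inflation ψ) ≤ fgMod L := by
  rintro X (⟨X', hX', ⟨e⟩⟩ | ⟨X', hX', ⟨e⟩⟩)
  · exact fgMod_of_epi e.hom ((h.fgMod₁_iff X').2 (hMA.le_fgMod _ hX'))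
  · exact fgMod_of_epi e.hom ((h.fgMod₂_iff X').2 (hMB.le_fgMod _ hX'))

/-- If `Ext` vanishes within `MA` and within `MB` in all degrees in `V`, then it vanishes within
`add {MA, MB}` in those degrees. -/
lemma subsingleton_ext_of_addClosure [IsNoetherianRing Lᵐᵒᵖ] (hMA : IsClusterTilting d MA)
    (hMB : IsClusterTilting d MB) (V : ℕ → Prop) (hV₀ : ¬ V 0)
    (hV : ∀ j l, V (j + l) → V j ∨ V l)
    (hA : ∀ i, V i → ∀ X Y, MA X → MA Y → Subsingleton (Ext X Y i))
    (hB : ∀ i, V i → ∀ X Y, MB X → MB Y → Subsingleton (Ext X Y i)) (i : ℕ) (hi : V i)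
    {X Y : RightMod L} (hX : addClosure (MA.map (inflation φ) ⊔ MB.map (inflation ψ)) X)
    (hY : addClosure (MA.map (inflation φ) ⊔ MB.map (inflation ψ)) Y) :
    Subsingleton (Ext X Y i) := by
  refine addClosure_subsingleton_ext (fun X Y hX hY => ?_) hX hY
  have hA' : ∀ i, V i → ∀ X Y, MA.map (inflation φ) X → MA.map (inflation φ) Y →
      Subsingleton (Ext X Y i) := by
    rintro i hi X Y ⟨X', hX', ⟨eX⟩⟩ ⟨Y', hY', ⟨eY⟩⟩
    exact (Retract.ofIso eX.symm).subsingleton_ext (Retract.ofIso eY.symm) i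
      ((h.subsingleton_ext₁_iff X' Y' i).2 (hA i hi X' Y' hX' hY'))
  have hB' : ∀ i, V i → ∀ X Y, MB.map (inflation ψ) X → MB.map (inflation ψ) Y →
      Subsingleton (Ext X Y i) := by
    rintro i hi X Y ⟨X', hX', ⟨eX⟩⟩ ⟨Y', hY', ⟨eY⟩⟩
    exact (Retract.ofIso eX.symm).subsingleton_ext (Retract.ofIso eY.symm) i
      ((h.subsingleton_ext₂_iff X' Y' i).2 (hB i hi X' Y' hX' hY'))
  have hXf : Module.Finite Lᵐᵒᵖ X := h.map₁_sup_map₂_le_fgMod hMA hMB X hX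
  have hYf : Module.Finite Lᵐᵒᵖ Y := h.map₁_sup_map₂_le_fgMod hMA hMB Y hY
  rcases hX with hX | hX <;> rcases hY with hY | hY
  · exact hA' i hi X Y hX hY
  · obtain ⟨X', -, ⟨eX⟩⟩ := hX
    obtain ⟨Y', -, ⟨eY⟩⟩ := hY
    -- Degree zero must be excluded: nonzero morphisms from `A`-modules to `B`-modules through the
    -- glued vertex do exist.
    obtain ⟨i, rfl⟩ := Nat.exists_eq_succ_of_ne_zero (fun h0 => hV₀ (h0 ▸ hi))
    exact h.subsingleton_ext_succ (killedBy_of_iso eX (h.killedBy₁_obj X'))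
      (killedBy_of_iso eY (h.killedBy₂_obj Y')) i
  · have hX₂ : killedBy f₂ X := by
      obtain ⟨X', -, ⟨eX⟩⟩ := hX
      exact killedBy_of_iso eX (h.killedBy₂_obj X')
    have hY₁ : killedBy f₁ Y := by
      obtain ⟨Y', -, ⟨eY⟩⟩ := hY
      exact killedBy_of_iso eY (h.killedBy₁_obj Y')
    -- A test module `T` lies in both subcategories, so `hB'` treats `Ext(X, T)` and `hA'` treats
    -- `Ext(T, Y)`; `hV` decides which of the two is used.
    refine h.subsingleton_ext hY₁ hX₂ i (fun j l hjl => ?_) fun T hT hT₁ hT₂ =>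
      hB' i hi X T hX (h.map₂_of_killedBy hMB hT hT₁ hT₂)
    rcases hV j l (hjl ▸ hi) with hj | hl
    · exact Or.inl fun T hT hT₁ hT₂ => hB' j hj X T hX (h.map₂_of_killedBy hMB hT hT₁ hT₂)
    · exact Or.inr fun T hT hT₁ hT₂ => hA' l hl T Y (h.map₁_of_killedBy hMA hT hT₁ hT₂) hY
  · exact hB' i hi X Y hX hY

omit h in
/-- A morphism between a module killed by `f₁` and a module killed by `f₂` factors through a
module killed by both. -/
lemma exists_factorization {X Y : RightMod L} (hX : fgMod L X) (f : X ⟶ Y)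
    (hf₁ : killedBy f₁ X ∨ killedBy f₁ Y) (hf₂ : killedBy f₂ X ∨ killedBy f₂ Y) :
    ∃ (T : RightMod L) (p : X ⟶ T) (q : T ⟶ Y), fgMod L T ∧ killedBy f₁ T ∧ killedBy f₂ T ∧
      p ≫ q = f := by
  have key : ∀ r : Lᵐᵒᵖ, killedBy r X ∨ killedBy r Y →
      killedBy r (ModuleCat.of Lᵐᵒᵖ f.hom.range) := by
    rintro r (hr | hr) ⟨_, x, rfl⟩
    · refine Subtype.ext ?_
      change r • f.hom x = 0
      rw [← map_smul, hr, map_zero]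
    · exact Subtype.ext (hr _)
  have : Module.Finite Lᵐᵒᵖ X := hX
  exact ⟨ModuleCat.of Lᵐᵒᵖ f.hom.range, ModuleCat.ofHom f.hom.rangeRestrict,
    ModuleCat.ofHom f.hom.range.subtype, Module.Finite.range f.hom, key f₁ hf₁, key f₂ hf₂, rfl⟩

/-- An `MA`-approximation remains one against `MB`: a map from a `B`-module to an `A`-module factors
through its image, which is killed by both idempotents and hence belongs to `MA`. The three lemmas
after it use the same factorization. -/
lemma exists_lift₁ (hMA : IsClusterTilting d MA) (hMB : IsClusterTilting d MB)
    {X Z : RightMod A} (f : X ⟶ Z)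
    (hf : ∀ (X' : RightMod A) (g : X' ⟶ Z), MA X' → ∃ h : X' ⟶ X, h ≫ f = g)
    {W : RightMod L} (hW : (MA.map (inflation φ) ⊔ MB.map (inflation ψ)) W)
    (g : W ⟶ (inflation φ).obj Z) :
    ∃ g' : W ⟶ (inflation φ).obj X, g' ≫ (inflation φ).map f = g := by
  have := ModuleCat.full_restrictScalars h.surjective₁
  have hWf := h.map₁_sup_map₂_le_fgMod hMA hMB W hW
  rcases hW with hW | ⟨W', -, ⟨e⟩⟩
  · simpa using exists_lift_map_of_factors (inflation φ) f hf hW (𝟙 W) g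
  · obtain ⟨T, p, q, hT, hT₁, hT₂, rfl⟩ := exists_factorization (f₁ := f₁) (f₂ := f₂) hWf g
      (Or.inr (h.killedBy₁_obj Z)) (Or.inl (killedBy_of_iso e (h.killedBy₂_obj W')))
    exact exists_lift_map_of_factors (inflation φ) f hf (h.map₁_of_killedBy hMA hT hT₁ hT₂) p q

lemma exists_lift₂ (hMA : IsClusterTilting d MA) (hMB : IsClusterTilting d MB)
    {X Z : RightMod B} (f : X ⟶ Z)
    (hf : ∀ (X' : RightMod B) (g : X' ⟶ Z), MB X' → ∃ h : X' ⟶ X, h ≫ f = g)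
    {W : RightMod L} (hW : (MA.map (inflation φ) ⊔ MB.map (inflation ψ)) W)
    (g : W ⟶ (inflation ψ).obj Z) :
    ∃ g' : W ⟶ (inflation ψ).obj X, g' ≫ (inflation ψ).map f = g := by
  have := ModuleCat.full_restrictScalars h.surjective₂
  have hWf := h.map₁_sup_map₂_le_fgMod hMA hMB W hW
  rcases hW with ⟨W', -, ⟨e⟩⟩ | hW
  · obtain ⟨T, p, q, hT, hT₁, hT₂, rfl⟩ := exists_factorization (f₁ := f₁) (f₂ := f₂) hWf g
      (Or.inl (killedBy_of_iso e (h.killedBy₁_obj W'))) (Or.inr (h.killedBy₂_obj Z))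
    exact exists_lift_map_of_factors (inflation ψ) f hf (h.map₂_of_killedBy hMB hT hT₁ hT₂) p q
  · simpa using exists_lift_map_of_factors (inflation ψ) f hf hW (𝟙 W) g

lemma exists_desc₁ (hMA : IsClusterTilting d MA) {X Z : RightMod A} (hZ : fgMod A Z) (f : Z ⟶ X)
    (hf : ∀ (X' : RightMod A) (g : Z ⟶ X'), MA X' → ∃ h : X ⟶ X', f ≫ h = g)
    {W : RightMod L} (hW : (MA.map (inflation φ) ⊔ MB.map (inflation ψ)) W)
    (g : (inflation φ).obj Z ⟶ W) :
    ∃ g' : (inflation φ).obj X ⟶ W, (inflation φ).map f ≫ g' = g := by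
  have := ModuleCat.full_restrictScalars h.surjective₁
  rcases hW with hW | ⟨W', -, ⟨e⟩⟩
  · simpa using exists_desc_map_of_factors (inflation φ) f hf hW g (𝟙 W)
  · obtain ⟨T, p, q, hT, hT₁, hT₂, rfl⟩ := exists_factorization (f₁ := f₁) (f₂ := f₂)
      ((h.fgMod₁_iff Z).2 hZ) g
      (Or.inl (h.killedBy₁_obj Z)) (Or.inr (killedBy_of_iso e (h.killedBy₂_obj W')))
    exact exists_desc_map_of_factors (inflation φ) f hf (h.map₁_of_killedBy hMA hT hT₁ hT₂) p q

lemma exists_desc₂ (hMB : IsClusterTilting d MB) {X Z : RightMod B} (hZ : fgMod B Z) (f : Z ⟶ X)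
    (hf : ∀ (X' : RightMod B) (g : Z ⟶ X'), MB X' → ∃ h : X ⟶ X', f ≫ h = g)
    {W : RightMod L} (hW : (MA.map (inflation φ) ⊔ MB.map (inflation ψ)) W)
    (g : (inflation ψ).obj Z ⟶ W) :
    ∃ g' : (inflation ψ).obj X ⟶ W, (inflation ψ).map f ≫ g' = g := by
  have := ModuleCat.full_restrictScalars h.surjective₂
  rcases hW with ⟨W', -, ⟨e⟩⟩ | hW
  · obtain ⟨T, p, q, hT, hT₁, hT₂, rfl⟩ := exists_factorization (f₁ := f₁) (f₂ := f₂)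
      ((h.fgMod₂_iff Z).2 hZ) g
      (Or.inr (killedBy_of_iso e (h.killedBy₁_obj W'))) (Or.inl (h.killedBy₂_obj Z))
    exact exists_desc_map_of_factors (inflation ψ) f hf (h.map₂_of_killedBy hMB hT hT₁ hT₂) p q
  · simpa using exists_desc_map_of_factors (inflation ψ) f hf hW g (𝟙 W)

/-- The gluing of `d`-cluster tilting subcategories is `d`-cluster tilting. -/
theorem isClusterTilting_addClosure [IsNoetherianRing Lᵐᵒᵖ] (hMA : IsClusterTilting d MA)
    (hMB : IsClusterTilting d MB) :
    IsClusterTilting d (addClosure (MA.map (inflation φ) ⊔ MB.map (inflation ψ))) := by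
  have hle := addClosure_le_fgMod (h.map₁_sup_map₂_le_fgMod hMA hMB)
  have hFobj : ∀ X, MA X → (MA.map (inflation φ) ⊔ MB.map (inflation ψ)) ((inflation φ).obj X) :=
    fun X hX => Or.inl (MA.prop_map_obj _ hX)
  have hGobj : ∀ X, MB X → (MA.map (inflation φ) ⊔ MB.map (inflation ψ)) ((inflation ψ).obj X) :=
    fun X hX => Or.inr (MB.prop_map_obj _ hX)
  have hbiprod : ∀ X Y, MA X → MB Y →
      addClosure (MA.map (inflation φ) ⊔ MB.map (inflation ψ))
        ((inflation φ).obj X ⊞ (inflation ψ).obj Y) :=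
    fun X Y hX hY => addClosure_biprod (hFobj X hX) (hGobj Y hY)
  have hext : ∀ X Y, addClosure (MA.map (inflation φ) ⊔ MB.map (inflation ψ)) X →
      addClosure (MA.map (inflation φ) ⊔ MB.map (inflation ψ)) Y → ExtVanishes d X Y := by
    intro X Y hX hY i hi hid
    refine h.subsingleton_ext_of_addClosure hMA hMB (fun i => 0 < i ∧ i < d) (by simp) ?_ ?_ ?_ i
      ⟨hi, hid⟩ hX hY
    · intro j l hjl
      omega
    · exact fun i hi X Y hX hY => ((hMA.eq_left X).1 hX).2 Y hY i hi.1 hi.2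
    · exact fun i hi X Y hX hY => ((hMB.eq_left X).1 hX).2 Y hY i hi.1 hi.2
  refine ⟨hle, fun C hC => ?_, fun C hC => ?_, fun C hC => ?_, fun C hC => ?_,
    fun C => ⟨fun hC => ⟨hle C hC, fun Y hY => hext C Y hC hY⟩, ?_⟩,
    fun C => ⟨fun hC => ⟨hle C hC, fun Y hY => hext Y C hY hC⟩, ?_⟩⟩
  · obtain ⟨X, Y, hX, hY, ⟨e⟩⟩ := h.exists_iso_biprod_inflation hC
    obtain ⟨P, p, hP, hp⟩ := hMA.contravariantlyFinite X hX
    obtain ⟨Q, q, hQ, hq⟩ := hMB.contravariantlyFinite Y hY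
    refine ⟨_, biprod.map ((inflation φ).map p) ((inflation ψ).map q) ≫ e.inv, hbiprod P Q hP hQ,
      addClosure_exists_lift _ fun W g hW => ?_⟩
    obtain ⟨g₁, hg₁⟩ := h.exists_lift₁ hMA hMB p hp hW (g ≫ e.hom ≫ biprod.fst)
    obtain ⟨g₂, hg₂⟩ := h.exists_lift₂ hMA hMB q hq hW (g ≫ e.hom ≫ biprod.snd)
    refine ⟨biprod.lift g₁ g₂, ?_⟩
    rw [← Category.assoc, Iso.comp_inv_eq]
    apply biprod.hom_ext <;> simp [hg₁, hg₂]
  · obtain ⟨X, Y, hX, hY, ⟨e⟩⟩ := h.exists_iso_biprod_inflation hC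
    obtain ⟨P, p, hP, hp⟩ := hMA.covariantlyFinite X hX
    obtain ⟨Q, q, hQ, hq⟩ := hMB.covariantlyFinite Y hY
    refine ⟨_, e.hom ≫ biprod.map ((inflation φ).map p) ((inflation ψ).map q), hbiprod P Q hP hQ,
      addClosure_exists_desc _ fun W g hW => ?_⟩
    obtain ⟨g₁, hg₁⟩ := h.exists_desc₁ hMA hX p hp hW (biprod.inl ≫ e.inv ≫ g)
    obtain ⟨g₂, hg₂⟩ := h.exists_desc₂ hMB hY q hq hW (biprod.inr ≫ e.inv ≫ g)
    refine ⟨biprod.desc g₁ g₂, ?_⟩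
    rw [Category.assoc, ← Iso.eq_inv_comp]
    apply biprod.hom_ext' <;> simp [hg₁, hg₂]
  · obtain ⟨X, Y, hX, hY, ⟨e⟩⟩ := h.exists_iso_biprod_inflation hC
    obtain ⟨P, p, hP, hp⟩ := hMA.generating X hX
    obtain ⟨Q, q, hQ, hq⟩ := hMB.generating Y hY
    exact ⟨_, biprod.map ((inflation φ).map p) ((inflation ψ).map q) ≫ e.inv, hbiprod P Q hP hQ,
      inferInstance⟩
  · obtain ⟨X, Y, hX, hY, ⟨e⟩⟩ := h.exists_iso_biprod_inflation hC
    obtain ⟨P, p, hP, hp⟩ := hMA.cogenerating X hX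
    obtain ⟨Q, q, hQ, hq⟩ := hMB.cogenerating Y hY
    exact ⟨_, e.hom ≫ biprod.map ((inflation φ).map p) ((inflation ψ).map q), hbiprod P Q hP hQ,
      inferInstance⟩
  · rintro ⟨hC, hC'⟩
    obtain ⟨X, Y, hX, hY, ⟨e⟩⟩ := h.exists_iso_biprod_inflation hC
    let rX : Retract ((inflation φ).obj X) C :=
      { i := biprod.inl ≫ e.inv, r := e.hom ≫ biprod.fst }
    let rY : Retract ((inflation ψ).obj Y) C :=
      { i := biprod.inr ≫ e.inv, r := e.hom ≫ biprod.snd }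
    -- The two summands of `C` inherit its `Ext`-vanishing as retracts, and each is then tested only
    -- against its own subcategory.
    refine addClosure_of_retract (Retract.ofIso e) (hbiprod X Y
      ((hMA.eq_left X).2 ⟨hX, fun Z hZ i hi hid => ?_⟩)
      ((hMB.eq_left Y).2 ⟨hY, fun Z hZ i hi hid => ?_⟩))
    · exact (h.subsingleton_ext₁_iff X Z i).1 (rX.subsingleton_ext (Retract.refl _) i
        (hC' _ (le_addClosure _ (hFobj Z hZ)) i hi hid))
    · exact (h.subsingleton_ext₂_iff Y Z i).1 (rY.subsingleton_ext (Retract.refl _) i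
        (hC' _ (le_addClosure _ (hGobj Z hZ)) i hi hid))
  · rintro ⟨hC, hC'⟩
    obtain ⟨X, Y, hX, hY, ⟨e⟩⟩ := h.exists_iso_biprod_inflation hC
    let rX : Retract ((inflation φ).obj X) C :=
      { i := biprod.inl ≫ e.inv, r := e.hom ≫ biprod.fst }
    let rY : Retract ((inflation ψ).obj Y) C :=
      { i := biprod.inr ≫ e.inv, r := e.hom ≫ biprod.snd }
    refine addClosure_of_retract (Retract.ofIso e) (hbiprod X Y
      ((hMA.eq_right X).2 ⟨hX, fun Z hZ i hi hid => ?_⟩)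
      ((hMB.eq_right Y).2 ⟨hY, fun Z hZ i hi hid => ?_⟩))
    · exact (h.subsingleton_ext₁_iff Z X i).1 ((Retract.refl _).subsingleton_ext rX i
        (hC' _ (le_addClosure _ (hFobj Z hZ)) i hi hid))
    · exact (h.subsingleton_ext₂_iff Z Y i).1 ((Retract.refl _).subsingleton_ext rY i
        (hC' _ (le_addClosure _ (hGobj Z hZ)) i hi hid))

/-- The gluing of `dℤ`-cluster tilting subcategories is `dℤ`-cluster tilting. -/
theorem isZClusterTilting_addClosure [IsNoetherianRing Lᵐᵒᵖ] (hMA : IsZClusterTilting d MA)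
    (hMB : IsZClusterTilting d MB) :
    IsZClusterTilting d (addClosure (MA.map (inflation φ) ⊔ MB.map (inflation ψ))) where
  toIsClusterTilting :=
    h.isClusterTilting_addClosure hMA.toIsClusterTilting hMB.toIsClusterTilting
  dvd_of_ext_ne_zero X Y hX hY i hi := by
    by_contra hid
    -- The degrees not divisible by `d`: they omit `0`, and if `d` divides both `j` and `l` it
    -- divides `j + l`.
    refine hi (h.subsingleton_ext_of_addClosure hMA.toIsClusterTilting hMB.toIsClusterTilting
      (fun i => ¬ d ∣ i) (by simp) (fun j l hjl => ?_) ?_ ?_ i hid hX hY)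
    · by_contra! hc
      exact hjl (dvd_add hc.1 hc.2)
    · exact fun i hi X Y hX hY => by_contra fun hc => hi (hMA.dvd_of_ext_ne_zero X Y hX hY i hc)
    · exact fun i hi X Y hX hY => by_contra fun hc => hi (hMB.dvd_of_ext_ne_zero X Y hX hY i hc)

end IsIdempotentGluing

/-! ### The glued algebra as a gluing along idempotents -/

namespace PathAlgebra

variable {k : Type u} [Field k] {V W : Type u} [Quiver.{u} V] [Quiver.{u} W]

/-- Injectivity on vertices keeps non-composable paths non-composable, so vanishing products are
respected too. -/
lemma map_mul_of_injective (F : V ⥤q W) (hF : Function.Injective F.obj) (x y : PathAlgebra k V) :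
    map k F (x * y) = map k F x * map k F y := by
  induction x using induction_path with
  | zero => simp [PathAlgebra.zero_mul']
  | add x x' h h' => simp [PathAlgebra.add_mul', h, h']
  | smul c x h => simp [PathAlgebra.smul_mul', h]
  | path i j p =>
    induction y using induction_path with
    | zero => simp [PathAlgebra.mul_zero']
    | add x x' h h' => simp [PathAlgebra.mul_add', h, h']
    | smul c x h => simp [PathAlgebra.mul_smul', h]
    | path i' j' p' =>
      by_cases h : j' = i
      · subst h
        simp only [map_ofPath, ofPath_mul_ofPath, Prefunctor.mapPath_comp]
      · rw [ofPath_mul_ofPath_of_ne _ _ h, map_ofPath, map_ofPath,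
          ofPath_mul_ofPath_of_ne _ _ (hF.ne h), map_zero]

/-- The corner of the path algebra at a vertex without nontrivial cycles consists of scalars. -/
lemma exists_vertex_mul_mul_vertex [Finite V] {v : V} (hv : ∀ p : Quiver.Path v v, p.length = 0)
    (x : PathAlgebra k V) : ∃ c : k, vertex k v * x * vertex k v = c • vertex k v := by
  induction x using induction_path with
  | zero => exact ⟨0, by simp⟩
  | add x y hx hy =>
    obtain ⟨c, hc⟩ := hx
    obtain ⟨d, hd⟩ := hy
    exact ⟨c + d, by rw [mul_add, add_mul, hc, hd, add_smul]⟩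
  | smul c x hx =>
    obtain ⟨d, hd⟩ := hx
    exact ⟨c * d, by simp [hd, mul_smul]⟩
  | path i j p =>
    by_cases hj : j = v
    · by_cases hi : i = v
      · subst hj; subst hi
        obtain rfl := Quiver.Path.eq_nil_of_length_zero p (hv p)
        refine ⟨1, ?_⟩
        change vertex k i * vertex k i * vertex k i = _
        rw [vertex_mul_self, vertex_mul_self, one_smul]
      · refine ⟨0, ?_⟩
        rw [mul_assoc, vertex, ofPath_mul_ofPath_of_ne p _ (Ne.symm hi), mul_zero, zero_smul]
    · refine ⟨0, ?_⟩
      rw [vertex, ofPath_mul_ofPath_of_ne _ p hj, zero_mul, zero_smul]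

lemma ofPath_cons {i j l : V} (p : Quiver.Path i j) (α : j ⟶ l) :
    ofPath k (p.cons α) = arrow k α * ofPath k p :=
  (ofPath_mul_ofPath α.toPath p).symm

end PathAlgebra

namespace Gluing

open PathAlgebra

section

variable {VA VB : Type u} (a : VA) (b : VB)

open Classical in
lemma eq_of_inA_eq_inB {i : VA} {j : VB} (h : inA a b i = inB a b j) : i = a ∧ j = b := by
  let r : GluedVertex a b → Option VA :=
    Quot.lift (Sum.elim some fun j => if j = b then some a else none)
      (by rintro _ _ ⟨rfl, rfl⟩; simp)
  have h' : some i = if j = b then some a else none := congrArg r h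
  split_ifs at h' with hj
  exact ⟨Option.some_injective _ h', hj⟩

variable {k : Type u} [Field k] [Quiver.{u} VA] [Quiver.{u} VB] [Finite VA] [Finite VB]

/-! ### Multiplication by `e_A` and `e_B` in the path algebra of the glued quiver -/

lemma eA_mul_ofPath {x : GluedVertex a b} {i : VA} (p : Quiver.Path x (inA a b i)) :
    eA k a b * ofPath k p = ofPath k p := by
  let := Fintype.ofFinite VA
  unfold eA
  rw [sum_mul', Finset.sum_eq_single i]
  · exact ofPath_mul_ofPath _ _
  · intro j _ hj
    exact ofPath_mul_ofPath_of_ne _ _ ((inA_injective a b).ne hj.symm)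
  · simp

lemma eA_mul_ofPath_of_ne {x : GluedVertex a b} {j : VB} (hj : j ≠ b)
    (p : Quiver.Path x (inB a b j)) : eA k a b * ofPath k p = 0 := by
  let := Fintype.ofFinite VA
  unfold eA
  rw [sum_mul']
  exact Finset.sum_eq_zero fun i _ => ofPath_mul_ofPath_of_ne _ _
    fun h => hj (eq_of_inA_eq_inB a b h.symm).2

lemma ofPath_mul_eA {y : GluedVertex a b} {i : VA} (p : Quiver.Path (inA a b i) y) :
    ofPath k p * eA k a b = ofPath k p := by
  let := Fintype.ofFinite VA
  unfold eA
  rw [mul_sum', Finset.sum_eq_single i]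
  · exact (ofPath_mul_ofPath _ _).trans (by rw [Quiver.Path.nil_comp])
  · intro j _ hj
    exact ofPath_mul_ofPath_of_ne _ _ ((inA_injective a b).ne hj)
  · simp

lemma vertex_mul_eB (j : VB) : vertex k (inB a b j) * eB k a b = vertex k (inB a b j) := by
  let := Fintype.ofFinite VB
  unfold eB
  rw [mul_sum', Finset.sum_eq_single j]
  · exact vertex_mul_self _
  · intro i _ hi
    exact vertex_mul_of_ne ((inB_injective a b).ne hi.symm)
  · simp

lemma vertex_mul_eB_of_ne {i : VA} (hi : i ≠ a) : vertex k (inA a b i) * eB k a b = 0 := by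
  let := Fintype.ofFinite VB
  unfold eB
  rw [mul_sum']
  exact Finset.sum_eq_zero fun j _ => vertex_mul_of_ne fun h => hi (eq_of_inA_eq_inB a b h).1

lemma vertex_mul_map_inclB {i : VA} (hi : i ≠ a) (x : PathAlgebra k VB) :
    vertex k (inA a b i) * PathAlgebra.map k (inclB a b) x = 0 := by
  induction x using induction_path with
  | zero => simp
  | add x y hx hy => rw [map_add, mul_add, hx, hy, add_zero]
  | smul c x hx => simp [hx]
  | path j l p =>
    rw [map_ofPath]
    exact ofPath_mul_ofPath_of_ne _ _ fun h => hi (eq_of_inA_eq_inB a b h.symm).1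

lemma pathToA_ofPath {x y : GluedVertex a b} (p : Quiver.Path x y) :
    pathToA k a b (ofPath k p) = evalPath (vertexToA k a b) (arrowToA k a b) p :=
  lift_ofPath _ _ _ _ _ _ _

lemma pathToB_ofPath {x y : GluedVertex a b} (p : Quiver.Path x y) :
    pathToB k a b (ofPath k p) = evalPath (vertexToB k a b) (arrowToB k a b) p :=
  lift_ofPath _ _ _ _ _ _ _

lemma map_inclA_vertex (i : VA) :
    PathAlgebra.map k (inclA a b) (vertex k i) = vertex k (inA a b i) := map_ofPath _ _ _

lemma map_inclB_vertex (j : VB) :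
    PathAlgebra.map k (inclB a b) (vertex k j) = vertex k (inB a b j) := map_ofPath _ _ _

/-- As `b` is a source, no arrow of `Q_B` ends at the glued vertex, so a path ending in `Q_A` lies
entirely in `Q_A`. Left multiplication by `e_A` thus selects exactly the paths of `Q_A`. -/
lemma eA_mul (hb : IsSource b) (x : PathAlgebra k (GluedVertex a b)) :
    eA k a b * x = PathAlgebra.map k (inclA a b) (pathToA k a b x) := by
  induction x using induction_path with
  | zero => simp
  | add x y hx hy => rw [mul_add, hx, hy, map_add, map_add]
  | smul c x hx => simp [hx]
  | path x y p =>
    induction p with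
    | nil =>
      rw [pathToA_ofPath, evalPath]
      rcases cases_A a b x with ⟨i, rfl⟩ | ⟨j, hj, rfl⟩
      · rw [eA_mul_ofPath, vertexToA_inA, map_inclA_vertex, vertex]
      · rw [eA_mul_ofPath_of_ne a b hj, vertexToA_inB a b j hj, map_zero]
    | cons p α ih =>
      rw [pathToA_ofPath] at ih ⊢
      rw [evalPath]
      rcases α with α | @⟨i, j, β⟩
      · change _ = PathAlgebra.map k (inclA a b) (arrow k α * _)
        rw [map_mul_of_injective _ (inA_injective a b), ← ih, eA_mul_ofPath, ← mul_assoc, arrow,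
          map_ofPath]
        exact (ofPath_cons _ _).trans (congrArg (· * ofPath k p)
          (ofPath_mul_eA a b ((inclA a b).mapPath α.toPath)).symm)
      · have hj : j ≠ b := by
          rintro rfl
          exact (hb _).false β
        change _ = PathAlgebra.map k (inclA a b) (0 * _)
        rw [eA_mul_ofPath_of_ne a b hj, zero_mul, map_zero]

/-- As `a` is a sink, a path starting in `Q_B` can never enter an arrow of `Q_A`. -/
lemma mul_eB (ha : IsSink a) (x : PathAlgebra k (GluedVertex a b)) :
    x * eB k a b = PathAlgebra.map k (inclB a b) (pathToB k a b x) := by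
  induction x using induction_path with
  | zero => simp
  | add x y hx hy => rw [add_mul, hx, hy, map_add, map_add]
  | smul c x hx => simp [hx]
  | path x y p =>
    induction p with
    | nil =>
      rw [pathToB_ofPath, evalPath]
      rcases cases_B a b x with ⟨j, rfl⟩ | ⟨i, hi, rfl⟩
      · exact (vertex_mul_eB a b j).trans (by rw [vertexToB_inB, map_inclB_vertex])
      · exact (vertex_mul_eB_of_ne a b hi).trans (by rw [vertexToB_inA a b i hi, map_zero])
    | cons p α ih =>
      rw [pathToB_ofPath] at ih ⊢
      rw [evalPath, ofPath_cons, mul_assoc, ih]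
      rcases α with @⟨i, j, α⟩ | β
      · have hi : i ≠ a := by
          rintro rfl
          exact (ha _).false α
        change _ = PathAlgebra.map k (inclB a b) (0 * _)
        rw [zero_mul, map_zero, ← arrow_mul_vertex, mul_assoc, vertex_mul_map_inclB a b hi, mul_zero]
      · change _ = PathAlgebra.map k (inclB a b) (arrow k β * _)
        rw [map_mul_of_injective _ (inB_injective a b)]
        congr 1
        exact (map_ofPath k (inclB a b) β.toPath).symm

lemma pathToA_eB : pathToA k a b (eB k a b) = vertex k a := by
  let := Fintype.ofFinite VB
  unfold eB
  rw [map_sum, Finset.sum_eq_single b]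
  · rw [← inA_eq_inB]
    exact pathToA_ofPath a b _
  · intro j _ hj
    exact (pathToA_ofPath a b _).trans (vertexToA_inB a b j hj)
  · simp

end

section

variable {k : Type u} [Field k] {VA VB : Type u} [Quiver.{u} VA] [Quiver.{u} VB]
  [Finite VA] [Finite VB] {a : VA} {b : VB}
  (RA : TwoSidedIdeal (PathAlgebra k VA)) (RB : TwoSidedIdeal (PathAlgebra k VB))

/-! ### Kernels of the projections and the corner at the glued vertex -/

lemma _root_.TwoSidedIdeal.mk'_eq_zero_iff {R : Type*} [Ring R] (I : TwoSidedIdeal R) (x : R) :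
    I.ringCon.mk' x = 0 ↔ x ∈ I := by
  rw [← map_zero I.ringCon.mk', TwoSidedIdeal.mem_iff]
  exact RingCon.eq _

lemma projA_mk (hb : IsSource b) (heb : vertex k b ∉ RB) (x : PathAlgebra k (GluedVertex a b)) :
    projA RA RB hb heb ((relations a b RA RB).ringCon.mk' x) =
      RA.ringCon.mk' (pathToA k a b x) := rfl

lemma projB_mk (ha : IsSink a) (hea : vertex k a ∉ RA) (x : PathAlgebra k (GluedVertex a b)) :
    projB RA RB ha hea ((relations a b RA RB).ringCon.mk' x) =
      RB.ringCon.mk' (pathToB k a b x) := rfl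

lemma map_inclA_mem {x : PathAlgebra k VA} (hx : x ∈ RA) :
    PathAlgebra.map k (inclA a b) x ∈ relations a b RA RB :=
  TwoSidedIdeal.subset_span (Or.inl (Or.inl ⟨x, hx, rfl⟩))

lemma map_inclB_mem {x : PathAlgebra k VB} (hx : x ∈ RB) :
    PathAlgebra.map k (inclB a b) x ∈ relations a b RA RB :=
  TwoSidedIdeal.subset_span (Or.inl (Or.inr ⟨x, hx, rfl⟩))

lemma sub_eA_mul_mul_sub_eB_mem (x : PathAlgebra k (GluedVertex a b)) :
    (1 - eA k a b) * x * (1 - eB k a b) ∈ relations a b RA RB :=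
  TwoSidedIdeal.subset_span (Or.inr ⟨x, rfl⟩)

/-- The kernel is `(1 - e_A) Λ`: by `eA_mul`, if the `A`-part of `x` lies in `RA`, then `e_A x` is
one of the relations. -/
lemma projA_eq_zero_iff (hb : IsSource b) (heb : vertex k b ∉ RB) (x : GluedAlgebra a b RA RB) :
    projA RA RB hb heb x = 0 ↔
      (1 - (relations a b RA RB).ringCon.mk' (eA k a b)) * x = x := by
  obtain ⟨x, rfl⟩ := RingCon.mk'_surjective _ x
  rw [sub_mul, one_mul, sub_eq_self, projA_mk]
  constructor
  · intro h
    rw [← map_mul, eA_mul a b hb, TwoSidedIdeal.mk'_eq_zero_iff]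
    exact map_inclA_mem RA RB ((TwoSidedIdeal.mk'_eq_zero_iff _ _).1 h)
  · intro h
    have := congrArg (projA RA RB hb heb) h
    rw [map_mul, projA_mk, projA_mk, pathToA_eA, map_one, one_mul, map_zero] at this
    exact this

lemma projB_eq_zero_iff (ha : IsSink a) (hea : vertex k a ∉ RA) (x : GluedAlgebra a b RA RB) :
    projB RA RB ha hea x = 0 ↔
      x * (1 - (relations a b RA RB).ringCon.mk' (eB k a b)) = x := by
  obtain ⟨x, rfl⟩ := RingCon.mk'_surjective _ x
  rw [mul_sub, mul_one, sub_eq_self, projB_mk]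
  constructor
  · intro h
    rw [← map_mul, mul_eB a b ha, TwoSidedIdeal.mk'_eq_zero_iff]
    exact map_inclB_mem RA RB ((TwoSidedIdeal.mk'_eq_zero_iff _ _).1 h)
  · intro h
    have := congrArg (projB RA RB ha hea) h
    rw [map_mul, projB_mk, projB_mk, pathToB_eB, map_one, mul_one, map_zero] at this
    exact this

lemma sub_eA_mul_mul_sub_eB (x : GluedAlgebra a b RA RB) :
    (1 - (relations a b RA RB).ringCon.mk' (eA k a b)) * x *
      (1 - (relations a b RA RB).ringCon.mk' (eB k a b)) = 0 := by
  obtain ⟨x, rfl⟩ := RingCon.mk'_surjective _ x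
  rw [← map_one (relations a b RA RB).ringCon.mk', ← map_sub, ← map_sub, ← map_mul, ← map_mul,
    TwoSidedIdeal.mk'_eq_zero_iff]
  exact sub_eA_mul_mul_sub_eB_mem RA RB x

lemma projA_surjective (hb : IsSource b) (heb : vertex k b ∉ RB) :
    Function.Surjective (projA (a := a) RA RB hb heb) := fun x => by
  obtain ⟨x, rfl⟩ := RingCon.mk'_surjective _ x
  exact ⟨(relations a b RA RB).ringCon.mk' (PathAlgebra.map k (inclA a b) x),
    by rw [projA_mk, pathToA_map_inclA]⟩

lemma projB_surjective (ha : IsSink a) (hea : vertex k a ∉ RA) :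
    Function.Surjective (projB (b := b) RA RB ha hea) := fun x => by
  obtain ⟨x, rfl⟩ := RingCon.mk'_surjective _ x
  exact ⟨(relations a b RA RB).ringCon.mk' (PathAlgebra.map k (inclB a b) x),
    by rw [projB_mk, pathToB_map_inclB]⟩

lemma exists_corner_eq_smul (ha : IsSink a) (hb : IsSource b) (x : GluedAlgebra a b RA RB) :
    let s := 1 - (1 - (relations a b RA RB).ringCon.mk' (eA k a b)) -
      (1 - (relations a b RA RB).ringCon.mk' (eB k a b))
    ∃ c : k, s * x * s = c • s := by
  intro s
  -- Expanding `(1 - e_A)(1 - e_B) = 0` in `Λ` gives `e_A + e_B - 1 = e_A e_B`, and `e_A e_B` is the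
  -- glued vertex.
  have hs : s = (relations a b RA RB).ringCon.mk' (vertex k (inA a b a)) := by
    have h := sub_eA_mul_mul_sub_eB (a := a) (b := b) RA RB 1
    rw [← map_inclA_vertex, ← pathToA_eB a b, ← eA_mul a b hb, map_mul, ← sub_eq_zero, ← neg_eq_zero,
      ← h]
    simp only [s]
    noncomm_ring
  obtain ⟨x, rfl⟩ := RingCon.mk'_surjective _ x
  obtain ⟨c, hc⟩ := exists_vertex_mul_mul_vertex (length_eq_zero_of_isSink ha)
    (pathToA k a b x)
  refine ⟨c, ?_⟩
  have hv : pathToA k a b (vertex k (inA a b a)) = vertex k a := pathToA_ofPath a b _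
  have h : vertex k (inA a b a) * x * vertex k (inA a b a) = c • vertex k (inA a b a) := by
    have h1 : eA k a b * vertex k (inA a b a) = vertex k (inA a b a) := eA_mul_ofPath a b _
    have h2 : vertex k (inA a b a) * x * vertex k (inA a b a) =
        eA k a b * (vertex k (inA a b a) * x * vertex k (inA a b a)) := by
      rw [← mul_assoc, ← mul_assoc, h1]
    rw [h2, eA_mul a b hb, map_mul (pathToA k a b), map_mul (pathToA k a b), hv, hc,
      map_smul, map_inclA_vertex]
  rw [hs, ← map_mul, ← map_mul, h]
  rfl

/-- Passing to opposite rings turns the kernels `(1 - e_A) Λ` and `Λ (1 - e_B)` into `R f₁` and `f₂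
R`, and the third family of relations into `f₂ R f₁ = 0`. -/
lemma isIdempotentGluing (ha : IsSink a) (hb : IsSource b) (hea : vertex k a ∉ RA)
    (heb : vertex k b ∉ RB) :
    IsIdempotentGluing k (RingHom.op (projA RA RB hb heb)) (RingHom.op (projB RA RB ha hea))
      (MulOpposite.op (1 - (relations a b RA RB).ringCon.mk' (eA k a b)))
      (MulOpposite.op (1 - (relations a b RA RB).ringCon.mk' (eB k a b))) where
  surjective₁ x := by
    obtain ⟨y, hy⟩ := projA_surjective RA RB hb heb x.unop
    exact ⟨MulOpposite.op y, congrArg MulOpposite.op hy⟩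
  surjective₂ x := by
    obtain ⟨y, hy⟩ := projB_surjective RA RB ha hea x.unop
    exact ⟨MulOpposite.op y, congrArg MulOpposite.op hy⟩
  idem₁ := congrArg MulOpposite.op ((projA_eq_zero_iff RA RB hb heb _).1 (by
    rw [MulOpposite.unop_op, map_sub, map_one, projA_mk, pathToA_eA, map_one, sub_self]))
  idem₂ := congrArg MulOpposite.op ((projB_eq_zero_iff RA RB ha hea _).1 (by
    rw [MulOpposite.unop_op, map_sub, map_one, projB_mk, pathToB_eB, map_one, sub_self]))
  ker₁ r := (MulOpposite.op_eq_zero_iff _).trans ((projA_eq_zero_iff RA RB hb heb r.unop).trans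
    MulOpposite.op_injective.eq_iff.symm)
  ker₂ r := (MulOpposite.op_eq_zero_iff _).trans ((projB_eq_zero_iff RA RB ha hea r.unop).trans
    MulOpposite.op_injective.eq_iff.symm)
  mul_mul_eq_zero r := congrArg MulOpposite.op
    ((mul_assoc _ _ _).symm.trans (sub_eA_mul_mul_sub_eB RA RB r.unop))
  corner r := by
    obtain ⟨c, hc⟩ := exists_corner_eq_smul RA RB ha hb r.unop
    exact ⟨c, congrArg MulOpposite.op ((mul_assoc _ _ _).symm.trans hc)⟩

/-- `Λ` embeds linearly in `A × B`: an element of both kernels equals `(1 - e_A) x (1 - e_B)`, which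
is zero. This supplies the Noetherian hypothesis that keeps the submodules and syzygies in the `Ext`
arguments finitely generated. -/
lemma finiteDimensional_gluedAlgebra [FiniteDimensional k (QuiverAlgebra RA)]
    [FiniteDimensional k (QuiverAlgebra RB)] (ha : IsSink a) (hb : IsSource b)
    (hea : vertex k a ∉ RA) (heb : vertex k b ∉ RB) :
    FiniteDimensional k (GluedAlgebra a b RA RB) := by
  let F : GluedAlgebra a b RA RB →ₗ[k] QuiverAlgebra RA × QuiverAlgebra RB :=
    { toFun := fun x => (projA RA RB hb heb x, projB RA RB ha hea x)
      map_add' := fun x y => by rw [map_add, map_add, Prod.mk_add_mk]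
      map_smul' := fun c x => by
        obtain ⟨x, rfl⟩ := RingCon.mk'_surjective _ x
        refine Prod.ext ?_ ?_
        · exact congrArg RA.ringCon.mk' (map_smul (pathToA k a b) c x)
        · exact congrArg RB.ringCon.mk' (map_smul (pathToB k a b) c x) }
  refine FiniteDimensional.of_injective F ((injective_iff_map_eq_zero F).2 fun x hx => ?_)
  have h₁ := (projA_eq_zero_iff RA RB hb heb x).1 (congrArg Prod.fst hx)
  have h₂ := (projB_eq_zero_iff RA RB ha hea x).1 (congrArg Prod.snd hx)
  rw [← h₂, ← h₁]
  exact sub_eA_mul_mul_sub_eB RA RB x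

end

end Gluing

theorem mainTheorem8 {k : Type u} [Field k] {VA VB : Type u} [Quiver.{u} VA] [Quiver.{u} VB]
    [Finite VA] [Finite VB]
    (RA : TwoSidedIdeal (PathAlgebra k VA)) (RB : TwoSidedIdeal (PathAlgebra k VB))
    [FiniteDimensional k (QuiverAlgebra RA)] [FiniteDimensional k (QuiverAlgebra RB)]
    (a : VA) (b : VB) (ha : IsSink a) (hb : IsSource b)
    (hea : PathAlgebra.vertex k a ∉ RA) (heb : PathAlgebra.vertex k b ∉ RB)
    (d : ℕ) (hd : 0 < d)
    (MA : ObjectProperty (RightMod (QuiverAlgebra RA)))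
    (MB : ObjectProperty (RightMod (QuiverAlgebra RB)))
    (hMA : IsClusterTilting d MA) (hMB : IsClusterTilting d MB) :
    IsClusterTilting d (gluedSubcategory RA RB ha hb hea heb MA MB) ∧
      (IsZClusterTilting d MA → IsZClusterTilting d MB →
        IsZClusterTilting d (gluedSubcategory RA RB ha hb hea heb MA MB)) := by
  have := Gluing.finiteDimensional_gluedAlgebra RA RB ha hb hea heb
  have : IsNoetherianRing (Gluing.GluedAlgebra a b RA RB)ᵐᵒᵖ := IsNoetherianRing.of_finite k _
  have h := Gluing.isIdempotentGluing RA RB ha hb hea heb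
  exact ⟨h.isClusterTilting_addClosure hMA hMB, h.isZClusterTilting_addClosure⟩
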